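/- \textbf{Model.} Let $\Phi=\{X_i\}$ (the nodes) and $\Psi=\{U_j\}$ (the static users) be independent homogeneous Poisson point processes on $\mathbb{R}^2$ with intensities $\lambda>0$ and $\xi>0$. A mobile user starts from the origin at time $0$ and moves along a straight line at constant speed $v>0$. Let $X(t)\in\Phi$ be the node closest to the mobile user at time $t$, $L(t)$ its distance to the mobile user, and $\mathrm{SNR}(t)=p\,L(t)^{-\beta}/w$, where $p,w>0$ and $\beta>2$. Fix a threshold $\gamma>0$ and $a>0$, and for $s>0$ let $r_s=(p/(ws))^{1/\beta}$ be the radius of coverage for the SNR threshold $s$. The Shannon rate is $R(t)=a\log(1+\mathrm{SNR}(t))$ if $L(t)\le r_\gamma$ and $R(t)=0$ otherwise. Let $\hat N(t)$ be the number of static users in the closed disc of radius $r_\gamma$ centered at $X(t)$ if $L(t)\le r_\gamma$, and $\hat N(t)=0$ otherwise. The lower-bound shared-rate process is $\hat S(t)=R(t)/(\hat N(t)+1)$, $t\ge 0$. For $\delta>0$, an up-crossing of level $\delta$ is a time $t>0$ such that, for some $\varepsilon>0$, $\hat S<\delta$ on $(t-\varepsilon,t)$ and $\hat S\ge\delta$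 on $(t,t+\varepsilon)$. Let $\rho_\delta=r_{e^{\delta/a}-1}$ be the radius of coverage associated with the rate level $\delta$, i.e. the distance to the node at which $a\log(1+\mathrm{SNR})=\delta$, and let $f(\rho)=2\lambda v\rho$. \textbf{Corollary.} For every $\delta>0$, almost surely $\hat S$ has infinitely many up-crossings of level $\delta$, finitely many of them in every bounded time interval; let $T_1^{(\delta)}<T_2^{(\delta)}<\cdots$ be their times. For every fixed $n\ge 1$, the inter-arrival time $\hat Z_\delta=T^{(\delta)}_{n+1}-T^{(\delta)}_n$ satisfies $$ f(\rho_\delta)\,e^{-\xi\pi r_\gamma^2}\,\hat Z_\delta \xrightarrow{d} \mathrm{Exp}(1)\qquad\text{as }\delta\to\infty, $$ that is, $\mathbb{P}\big(f(\rho_\delta)e^{-\xi\pi r_\gamma^2}\hat Z_\delta\le x\big)\to \mathbb{P}(E\le x)$ for every $x\in\mathbb{R}$, where $E$ is exponentially distributed with mean $1$. -/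

import Mathlib

open MeasureTheory ProbabilityTheory Filter Topology Set

/-- The Euclidean plane. -/
abbrev Plane : Type := EuclideanSpace ℝ (Fin 2)

/-- The number (possibly infinite) of points of the configuration `x 0, x 1, x 2, …` in `B`. -/
noncomputable def pointCount (x : ℕ → Plane) (B : Set Plane) : ℕ∞ :=
  {i | x i ∈ B}.encard

/-- `X 0, X 1, X 2, …` are the points of a homogeneous Poisson point process on the plane with
the given intensity: the number of points in a Borel set of finite area is Poisson distributed
with mean intensity times area, and the numbers of points in disjoint Borel sets are
independent. -/
structure IsPoissonPointProcess {Ω : Type*} [MeasurableSpace Ω] (P : Measure Ω)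
    (X : ℕ → Ω → Plane) (intensity : ℝ) : Prop where
  measurable_point : ∀ i, Measurable (X i)
  count_law : ∀ B : Set Plane, MeasurableSet B → volume B ≠ ⊤ → ∀ k : ℕ,
    P {ω | pointCount (fun i => X i ω) B = k} =
      ENNReal.ofReal (Real.exp (-(intensity * (volume B).toReal)) *
        (intensity * (volume B).toReal) ^ k / (k.factorial : ℝ))
  count_indep : ∀ (n : ℕ) (B : Fin n → Set Plane), (∀ i, MeasurableSet (B i)) →
    Pairwise (fun i j => Disjoint (B i) (B j)) →
      iIndepFun (fun i ω => pointCount (fun m => X m ω) (B i)) P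

/-- The numerical parameters of the network: intensity `lam` of the nodes, intensity `xi` of the
static users, speed `v` and direction `dir` of the tagged mobile user, transmission power `p`,
noise power `w`, path loss exponent `beta`, bandwidth constant `a` and SNR threshold `gam` under
which no user is served. -/
structure NetworkParams where
  lam : ℝ
  xi : ℝ
  v : ℝ
  dir : Plane
  p : ℝ
  w : ℝ
  beta : ℝ
  a : ℝ
  gam : ℝ

namespace NetworkParams

/-- The standing assumptions on the parameters. -/
structure Admissible (M : NetworkParams) : Prop where
  lam_pos : 0 < M.lam
  xi_pos : 0 < M.xi
  v_pos : 0 < M.v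
  norm_dir : ‖M.dir‖ = 1
  p_pos : 0 < M.p
  w_pos : 0 < M.w
  two_lt_beta : 2 < M.beta
  a_pos : 0 < M.a
  gam_pos : 0 < M.gam

/-- The location of the tagged user at time `t`: it starts from the origin and moves along a
straight line with constant velocity. -/
noncomputable def position (M : NetworkParams) (t : ℝ) : Plane := (M.v * t) • M.dir

/-- The radius of coverage for the SNR threshold `s`: the distance from a node at which the SNR
equals `s`. -/
noncomputable def coverageRadius (M : NetworkParams) (s : ℝ) : ℝ :=
  (M.p / (M.w * s)) ^ (1 / M.beta)

/-- The radius associated with a rate level `δ`: the radius of coverage for the SNR threshold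
`exp (δ / a) - 1`, at which the unshared Shannon rate `a * log (1 + SNR)` equals `δ`. -/
noncomputable def rateRadius (M : NetworkParams) (δ : ℝ) : ℝ :=
  M.coverageRadius (Real.exp (δ / M.a) - 1)

end NetworkParams

/-- The Voronoi cell of the node `nodes i`. -/
def voronoiCell (nodes : ℕ → Plane) (i : ℕ) : Set Plane :=
  {y | ∀ j, dist y (nodes i) ≤ dist y (nodes j)}

/-- The Johnson--Mehl cell of the node `nodes i` with radius `r`. -/
def johnsonMehlCell (nodes : ℕ → Plane) (r : ℝ) (i : ℕ) : Set Plane :=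
  voronoiCell nodes i ∩ Metric.closedBall (nodes i) r

/-- The index of the node closest to `y`, the smallest one in case of a tie (along the path of
the mobile user, ties occur almost surely at isolated instants only). -/
noncomputable def closestIndex (nodes : ℕ → Plane) (y : Plane) : ℕ :=
  sInf {i | y ∈ voronoiCell nodes i}

namespace NetworkParams

/-- `X(t)`: the node closest to the mobile user at time `t`. -/
noncomputable def closestNode (M : NetworkParams) (nodes : ℕ → Plane) (t : ℝ) : Plane :=
  nodes (closestIndex nodes (M.position t))

/-- `L(t)`: the distance from the mobile user to its closest node at time `t`. -/
noncomputable def distClosest (M : NetworkParams) (nodes : ℕ → Plane) (t : ℝ) : ℝ :=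
  dist (M.position t) (M.closestNode nodes t)

/-- The signal-to-noise ratio of the mobile user at time `t`. -/
noncomputable def snr (M : NetworkParams) (nodes : ℕ → Plane) (t : ℝ) : ℝ :=
  M.p * M.distClosest nodes t ^ (-M.beta) / M.w

/-- `R(t)`: the Shannon rate, which is zero if the mobile user is not covered. -/
noncomputable def shannonRate (M : NetworkParams) (nodes : ℕ → Plane) (t : ℝ) : ℝ :=
  if M.distClosest nodes t ≤ M.coverageRadius M.gam then
    M.a * Real.log (1 + M.snr nodes t)
  else 0

open Classical in
/-- The upper bound of the sharing number: the number of static users in the closed disc centered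
at the closest node with the radius of coverage if the mobile user is in the Johnson--Mehl cell
of that node, and zero otherwise. -/
noncomputable def upperSharingNumber (M : NetworkParams) (nodes users : ℕ → Plane) (t : ℝ) : ℕ :=
  if M.position t ∈ johnsonMehlCell nodes (M.coverageRadius M.gam)
      (closestIndex nodes (M.position t)) then
    (pointCount users
      (Metric.closedBall (M.closestNode nodes t) (M.coverageRadius M.gam))).toNat
  else 0

/-- The lower bound of the shared rate. -/
noncomputable def lowerSharedRate (M : NetworkParams) (nodes users : ℕ → Plane) (t : ℝ) : ℝ :=
  M.shannonRate nodes t * (1 / ((M.upperSharingNumber nodes users t : ℝ) + 1))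

end NetworkParams

/-- The set of the times `t > 0` at which the path `S` up-crosses the level `δ`: it is below `δ`
right before `t` and not below `δ` right after `t`. -/
def upCrossingSet (S : ℝ → ℝ) (δ : ℝ) : Set ℝ :=
  {t | 0 < t ∧ ∃ ε > 0, (∀ s ∈ Ioo (t - ε) t, S s < δ) ∧ ∀ s ∈ Ioo t (t + ε), δ ≤ S s}

/-- The time of the `n`-th up-crossing of the level `δ` by the path `S` (for `n = 1, 2, …`). It is
meaningful if there are infinitely many up-crossings, finitely many in every bounded interval. -/
noncomputable def nthUpCrossing (S : ℝ → ℝ) (δ : ℝ) (n : ℕ) : ℝ :=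
  sInf {t | 0 ≤ t ∧ (n : ℕ∞) ≤ (upCrossingSet S δ ∩ Iic t).encard}

/-!
At a high level `δ` the rate radius `ρ = M.rateRadius δ` is tiny. A node within distance `ρ` of the
path produces an up-crossing as soon as its disc of coverage contains no user; a node with at least
one user has to come within the much smaller distance `M.rateRadius (2 * δ)`, which is negligible.
Away from configurations of vanishing probability (nodes too close to each other, to the axis of the
path or to the ends of the observation window), the up-crossings up to a given time are therefore in
bijection with the nodes without users in the tube of radius `ρ` around the path.

Given the users, these nodes form a Poisson process with intensity `M.lam` on the random region of
the points at distance more than `M.coverageRadius M.gam` from every user. The area of the part of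
this region in a long thin tube has relative variance tending to zero, since distant parts are
uncorrelated, so it may be replaced by its mean. Hence the counts along the path, in rescaled time,
have asymptotically exponential void probabilities independent of the past, and no multiple points
in short intervals. Locating the `n`-th up-crossing on a fine grid turns these two facts into the
exponential limit of the gap that follows it.
-/

theorem pointCount_eq_zero_iff (x : ℕ → Plane) (B : Set Plane) :
    pointCount x B = 0 ↔ ∀ i, x i ∉ B := by
  simp [pointCount, eq_empty_iff_forall_notMem]

theorem one_le_pointCount_iff (x : ℕ → Plane) (B : Set Plane) :
    1 ≤ pointCount x B ↔ ∃ i, x i ∈ B := by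
  rw [pointCount, one_le_encard_iff_nonempty]; rfl

theorem two_le_pointCount {x : ℕ → Plane} {B : Set Plane} {i j : ℕ} (hij : i ≠ j)
    (hi : x i ∈ B) (hj : x j ∈ B) : 2 ≤ pointCount x B := by
  rw [← encard_pair hij]
  exact encard_le_encard (pair_subset hi hj)

theorem pointCount_mono (x : ℕ → Plane) {B C : Set Plane} (h : B ⊆ C) :
    pointCount x B ≤ pointCount x C :=
  encard_le_encard fun _ hi => h hi

theorem pointCount_union (x : ℕ → Plane) {B C : Set Plane} (h : Disjoint B C) :
    pointCount x (B ∪ C) = pointCount x B + pointCount x C :=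
  encard_union_eq (h.preimage x)

theorem measurable_pointCount {α : Type*} [MeasurableSpace α] {x : ℕ → α → Plane}
    {B : α → Set Plane} (h : ∀ i, MeasurableSet {a | x i a ∈ B a}) :
    Measurable fun a => pointCount (fun i => x i a) (B a) :=
  measurable_encard.comp (measurable_set_iff.2 fun i => measurable_mem.2 (h i))

theorem pairwise_disjoint_setOf_eq_natCast {α : Type*} (f : α → ℕ∞) :
    Pairwise fun j k : ℕ => Disjoint {a | f a = j} {a | f a = k} :=
  (pairwise_disjoint_fiber f).comp_of_injective Nat.cast_injective

theorem setOf_lt_natCast_eq_iUnion {α : Type*} (f : α → ℕ∞) (n : ℕ) :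
    {a | f a < n} = ⋃ k ∈ Finset.range n, {a | f a = (k : ℕ)} := by
  ext a
  cases h : f a <;> simp [h]

theorem setOf_ne_top_eq_iUnion {α : Type*} (f : α → ℕ∞) :
    {a | f a ≠ ⊤} = ⋃ k : ℕ, {a | f a = k} := by
  ext a
  cases h : f a <;> simp [h]

namespace IsPoissonPointProcess

variable {Ω : Type*} [MeasurableSpace Ω] {P : Measure Ω} {X : ℕ → Ω → Plane} {lam : ℝ}

theorem measurable_count (hX : IsPoissonPointProcess P X lam) {B : Set Plane}
    (hB : MeasurableSet B) : Measurable (fun ω => pointCount (fun i => X i ω) B) :=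
  measurable_pointCount fun i => hX.measurable_point i hB

theorem measurableSet_count (hX : IsPoissonPointProcess P X lam) {B : Set Plane}
    (hB : MeasurableSet B) (K : Set ℕ∞) :
    MeasurableSet {ω | pointCount (fun i => X i ω) B ∈ K} :=
  hX.measurable_count hB MeasurableSet.of_discrete

theorem indepFun_count (hX : IsPoissonPointProcess P X lam) {B C : Set Plane}
    (hB : MeasurableSet B) (hC : MeasurableSet C) (hBC : Disjoint B C) :
    IndepFun (fun ω => pointCount (fun i => X i ω) B)
      (fun ω => pointCount (fun i => X i ω) C) P := by
  have hmeas : ∀ i, MeasurableSet (![B, C] i) := by simp [Fin.forall_fin_two, hB, hC]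
  have hdisj : Pairwise fun i j => Disjoint (![B, C] i) (![B, C] j) := by
    simp [Pairwise, Fin.forall_fin_two, hBC, hBC.symm]
  exact (hX.count_indep 2 ![B, C] hmeas hdisj).indepFun (i := 0) (j := 1) (by decide)

variable [IsProbabilityMeasure P]

theorem intensity_pos (hX : IsPoissonPointProcess P X lam) : 0 < lam := by
  by_contra! hlam
  have hempty : ∀ᵐ ω ∂P, ∀ n : ℕ, pointCount (fun i => X i ω) (Metric.closedBall 0 n) = 0 := by
    refine ae_all_iff.2 fun n => ?_
    have hball : MeasurableSet (Metric.closedBall (0 : Plane) n) := measurableSet_closedBall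
    refine (mem_ae_iff_prob_eq_one (hX.measurableSet_count hball {0})).2
      (le_antisymm prob_le_one ?_)
    have hlaw := hX.count_law _ hball measure_closedBall_lt_top.ne 0
    simp only [CharP.cast_eq_zero, pow_zero, mul_one, Nat.factorial_zero, Nat.cast_one,
      div_one] at hlaw
    refine le_of_le_of_eq ?_ hlaw.symm
    rw [ENNReal.one_le_ofReal, Real.one_le_exp_iff, ← neg_mul]
    exact mul_nonneg (neg_nonneg.2 hlam) ENNReal.toReal_nonneg
  obtain ⟨ω, hω⟩ := hempty.exists
  obtain ⟨n, hn⟩ := exists_nat_ge (dist (X 0 ω) 0)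
  exact (pointCount_eq_zero_iff _ _).1 (hω n) 0 hn

theorem real_count_eq (hX : IsPoissonPointProcess P X lam) {B : Set Plane}
    (hB : MeasurableSet B) (hV : volume B ≠ ⊤) (k : ℕ) :
    P.real {ω | pointCount (fun i => X i ω) B = k} =
      Real.exp (-(lam * volume.real B)) * (lam * volume.real B) ^ k / (k.factorial : ℝ) := by
  have := hX.intensity_pos
  rw [measureReal_def, hX.count_law B hB hV k]
  exact ENNReal.toReal_ofReal (by positivity)

theorem real_count_eq_zero (hX : IsPoissonPointProcess P X lam) {B : Set Plane}
    (hB : MeasurableSet B) (hV : volume B ≠ ⊤) :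
    P.real {ω | pointCount (fun i => X i ω) B = 0} = Real.exp (-(lam * volume.real B)) := by
  simpa using hX.real_count_eq hB hV 0

theorem real_count_lt_inter_count_eq_zero (hX : IsPoissonPointProcess P X lam)
    {B C : Set Plane} (hB : MeasurableSet B) (hC : MeasurableSet C) (hVC : volume C ≠ ⊤)
    (hBC : Disjoint B C) (n : ℕ) :
    P.real {ω | pointCount (fun i => X i ω) B < n ∧ pointCount (fun i => X i ω) C = 0} =
      P.real {ω | pointCount (fun i => X i ω) B < n} * Real.exp (-(lam * volume.real C)) := by
  have h := (hX.indepFun_count hB hC hBC).measure_inter_preimage_eq_mul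
    (Iio (n : ℕ∞)) {0} MeasurableSet.of_discrete (measurableSet_singleton 0)
  rw [← hX.real_count_eq_zero hC hVC]
  exact (congrArg ENNReal.toReal h).trans ENNReal.toReal_mul

theorem real_one_le_count (hX : IsPoissonPointProcess P X lam) {B : Set Plane}
    (hB : MeasurableSet B) (hV : volume B ≠ ⊤) :
    P.real {ω | 1 ≤ pointCount (fun i => X i ω) B} = 1 - Real.exp (-(lam * volume.real B)) := by
  have hzero : MeasurableSet {ω | pointCount (fun i => X i ω) B = 0} :=
    hX.measurableSet_count hB {0}
  rw [← hX.real_count_eq_zero hB hV, ← probReal_compl_eq_one_sub hzero]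
  congr 1
  ext ω
  simp [Order.one_le_iff_ne_zero]

theorem real_one_le_count_le (hX : IsPoissonPointProcess P X lam) {B : Set Plane}
    (hB : MeasurableSet B) (hV : volume B ≠ ⊤) :
    P.real {ω | 1 ≤ pointCount (fun i => X i ω) B} ≤ lam * volume.real B := by
  rw [hX.real_one_le_count hB hV]
  linarith [Real.add_one_le_exp (-(lam * volume.real B))]

theorem real_count_lt (hX : IsPoissonPointProcess P X lam) {B : Set Plane}
    (hB : MeasurableSet B) (hV : volume B ≠ ⊤) (n : ℕ) :
    P.real {ω | pointCount (fun i => X i ω) B < n} =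
      ∑ k ∈ Finset.range n,
        Real.exp (-(lam * volume.real B)) * (lam * volume.real B) ^ k / (k.factorial : ℝ) := by
  rw [setOf_lt_natCast_eq_iUnion, measureReal_biUnion_finset
    ((pairwise_disjoint_setOf_eq_natCast _).set_pairwise _)
    fun k _ => hX.measurableSet_count hB {(k : ℕ∞)}]
  exact Finset.sum_congr rfl fun k _ => hX.real_count_eq hB hV k

theorem real_two_le_count_le (hX : IsPoissonPointProcess P X lam) {B : Set Plane}
    (hB : MeasurableSet B) (hV : volume B ≠ ⊤) :
    P.real {ω | 2 ≤ pointCount (fun i => X i ω) B} ≤ (lam * volume.real B) ^ 2 := by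
  have := hX.intensity_pos
  have hcompl : {ω | 2 ≤ pointCount (fun i => X i ω) B} =
      {ω | pointCount (fun i => X i ω) B < (2 : ℕ)}ᶜ := by
    ext ω; simp only [mem_ofPred_eq, mem_compl_iff, not_lt, Nat.cast_ofNat]
  have hlt : MeasurableSet {ω | pointCount (fun i => X i ω) B < (2 : ℕ)} :=
    hX.measurableSet_count hB (Iio (2 : ℕ))
  rw [hcompl, probReal_compl_eq_one_sub hlt, hX.real_count_lt hB hV]
  set m := lam * volume.real B
  have hm : 0 ≤ m := by positivity
  have hexp := Real.add_one_le_exp (-m)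
  simp only [Finset.sum_range_succ, Finset.sum_range_zero, pow_zero, pow_one, mul_one,
    Nat.factorial_zero, Nat.factorial_one, Nat.cast_one, div_one, zero_add]
  nlinarith

theorem ae_count_ne_top (hX : IsPoissonPointProcess P X lam) {B : Set Plane}
    (hB : MeasurableSet B) (hV : volume B ≠ ⊤) :
    ∀ᵐ ω ∂P, pointCount (fun i => X i ω) B ≠ ⊤ := by
  have hm : 0 ≤ lam * volume.real B := mul_nonneg hX.intensity_pos.le measureReal_nonneg
  refine (mem_ae_iff_prob_eq_one (hX.measurableSet_count hB {⊤}ᶜ)).2 ?_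
  change P {ω | pointCount (fun i => X i ω) B ≠ ⊤} = 1
  rw [setOf_ne_top_eq_iUnion, measure_iUnion (pairwise_disjoint_setOf_eq_natCast _)
    fun k => hX.measurableSet_count hB {(k : ℕ∞)}]
  have hsum : HasSum (fun k : ℕ => Real.exp (-(lam * volume.real B)) *
      (lam * volume.real B) ^ k / (k.factorial : ℝ)) 1 := hasSum_one_poissonMeasure ⟨_, hm⟩
  calc ∑' k : ℕ, P {ω | pointCount (fun i => X i ω) B = (k : ℕ)}
      = ∑' k : ℕ, ENNReal.ofReal (Real.exp (-(lam * volume.real B)) *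
          (lam * volume.real B) ^ k / (k.factorial : ℝ)) := tsum_congr (hX.count_law B hB hV)
    _ = 1 := by
      rw [← ENNReal.ofReal_tsum_of_nonneg (fun k => by positivity) hsum.summable,
        hsum.tsum_eq, ENNReal.ofReal_one]

theorem ae_finite_closedBall (hX : IsPoissonPointProcess P X lam) :
    ∀ᵐ ω ∂P, ∀ (y : Plane) (r : ℝ), {i | X i ω ∈ Metric.closedBall y r}.Finite := by
  have h : ∀ᵐ ω ∂P, ∀ n : ℕ, pointCount (fun i => X i ω) (Metric.closedBall 0 (n : ℝ)) ≠ ⊤ :=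
    ae_all_iff.2 fun n => hX.ae_count_ne_top measurableSet_closedBall measure_closedBall_lt_top.ne
  filter_upwards [h] with ω hω y r
  obtain ⟨n, hn⟩ := exists_nat_ge (r + dist y 0)
  exact (encard_ne_top_iff.1 (hω n)).subset fun i hi =>
    Metric.closedBall_subset_closedBall' hn hi

theorem ae_forall_notMem (hX : IsPoissonPointProcess P X lam) {B : Set Plane}
    (hB : MeasurableSet B) (hV : volume B = 0) : ∀ᵐ ω ∂P, ∀ i, X i ω ∉ B := by
  have h := hX.real_one_le_count_le hB (by simp [hV])
  rw [measureReal_def (μ := volume), hV, ENNReal.toReal_zero, mul_zero] at h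
  have hnull : P {ω | 1 ≤ pointCount (fun i => X i ω) B} = 0 :=
    (measureReal_eq_zero_iff).1 (le_antisymm h measureReal_nonneg)
  filter_upwards [measure_eq_zero_iff_ae_notMem.1 hnull] with ω hω i hi
  exact hω ((one_le_pointCount_iff _ _).2 ⟨i, hi⟩)

theorem real_forall_one_le_count (hX : IsPoissonPointProcess P X lam) {B : ℕ → Set Plane}
    (hB : ∀ k, MeasurableSet (B k)) (hV : ∀ k, volume (B k) ≠ ⊤)
    (hd : Pairwise fun i j => Disjoint (B i) (B j)) (n : ℕ) :
    P.real {ω | ∀ k : Fin n, 1 ≤ pointCount (fun i => X i ω) (B k)} =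
      ∏ k : Fin n, (1 - Real.exp (-(lam * volume.real (B k)))) := by
  have hind := hX.count_indep n (fun k => B k) (fun k => hB k)
    fun i j hij => hd (Fin.val_injective.ne hij)
  have h := hind.measure_inter_preimage_eq_mul Finset.univ (sets := fun _ => Ici 1)
    fun _ _ => MeasurableSet.of_discrete
  have hset : {ω | ∀ k : Fin n, 1 ≤ pointCount (fun i => X i ω) (B k)} =
      ⋂ k ∈ (Finset.univ : Finset (Fin n)),
        (fun ω => pointCount (fun i => X i ω) (B k)) ⁻¹' Ici 1 := by
    ext ω; simp
  rw [hset, measureReal_def, h, ENNReal.toReal_prod]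
  exact Finset.prod_congr rfl fun k _ => hX.real_one_le_count (hB k) (hV k)

theorem ae_exists_forall_notMem (hX : IsPoissonPointProcess P X lam) {B : ℕ → Set Plane}
    (hB : ∀ k, MeasurableSet (B k)) {V : ENNReal} (hV : V ≠ ⊤) (hBV : ∀ k, volume (B k) = V)
    (hd : Pairwise fun i j => Disjoint (B i) (B j)) : ∀ᵐ ω ∂P, ∃ k, ∀ i, X i ω ∉ B k := by
  set q := Real.exp (-(lam * V.toReal))
  have hq : 0 < q := Real.exp_pos _
  have hq1 : q ≤ 1 := Real.exp_le_one_iff.2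
    (neg_nonpos.2 (mul_nonneg hX.intensity_pos.le ENNReal.toReal_nonneg))
  have hbound : ∀ n : ℕ, P.real {ω | ¬ ∃ k, ∀ i, X i ω ∉ B k} ≤ (1 - q) ^ n := by
    intro n
    have h := hX.real_forall_one_le_count hB (fun k => by rwa [hBV]) hd n
    simp only [measureReal_def (μ := volume), hBV, Finset.prod_const, Finset.card_univ,
      Fintype.card_fin] at h
    refine (measureReal_mono fun ω hω k => ?_).trans h.le
    rw [one_le_pointCount_iff]
    by_contra! hempty
    exact hω ⟨k, hempty⟩
  have hlim : Tendsto (fun n : ℕ => (1 - q) ^ n) atTop (𝓝 0) :=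
    tendsto_pow_atTop_nhds_zero_of_lt_one (by linarith) (by linarith)
  exact (measureReal_eq_zero_iff).1 (le_antisymm (ge_of_tendsto' hlim hbound) measureReal_nonneg)

theorem ae_frequently_forall_notMem (hX : IsPoissonPointProcess P X lam) {B : ℕ → Set Plane}
    (hB : ∀ k, MeasurableSet (B k)) {V : ENNReal} (hV : V ≠ ⊤) (hBV : ∀ k, volume (B k) = V)
    (hd : Pairwise fun i j => Disjoint (B i) (B j)) :
    ∀ᵐ ω ∂P, ∃ᶠ k in atTop, ∀ i, X i ω ∉ B k := by
  have h : ∀ᵐ ω ∂P, ∀ m, ∃ k, ∀ i, X i ω ∉ B (m + k) := ae_all_iff.2 fun m =>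
    hX.ae_exists_forall_notMem (fun k => hB _) hV (fun k => hBV _)
      fun i j hij => hd (by simpa using hij)
  filter_upwards [h] with ω hω
  exact frequently_atTop.2 fun m => (hω m).elim fun k hk => ⟨m + k, Nat.le_add_right m k, hk⟩

end IsPoissonPointProcess

/-- The set of the points whose first coordinate in the basis `b` lies in `I` and whose second
coordinate lies in `J`. -/
def coordBox (b : OrthonormalBasis (Fin 2) ℝ Plane) (I J : Set ℝ) : Set Plane :=
  {y | b.repr y 0 ∈ I ∧ b.repr y 1 ∈ J}

section CoordBox

variable (b : OrthonormalBasis (Fin 2) ℝ Plane)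

theorem measurable_coord (i : Fin 2) : Measurable fun y : Plane => b.repr y i :=
  (by fun_prop : Continuous fun y : Plane => b.repr y i).measurable

theorem measurableSet_coordBox {I J : Set ℝ} (hI : MeasurableSet I) (hJ : MeasurableSet J) :
    MeasurableSet (coordBox b I J) :=
  (measurable_coord b 0 hI).inter (measurable_coord b 1 hJ)

theorem volume_coordBox {I J : Set ℝ} (hI : MeasurableSet I) (hJ : MeasurableSet J) :
    volume (coordBox b I J) = volume I * volume J := by
  have hmp : MeasurePreserving (fun y : Plane => WithLp.ofLp (b.repr y)) volume volume :=
    (PiLp.volume_preserving_ofLp (Fin 2)).comp b.measurePreserving_repr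
  have hms : MeasurableSet (Set.pi univ ![I, J]) :=
    MeasurableSet.univ_pi (by simp [Fin.forall_fin_two, hI, hJ])
  have hpre : coordBox b I J =
      (fun y : Plane => WithLp.ofLp (b.repr y)) ⁻¹' Set.pi univ ![I, J] := by
    ext y
    simp [coordBox, Fin.forall_fin_two]
  rw [hpre, hmp.measure_preimage hms.nullMeasurableSet, volume_pi_pi]
  simp [Fin.prod_univ_two]

theorem volume_real_coordBox {I J : Set ℝ} (hI : MeasurableSet I) (hJ : MeasurableSet J) :
    volume.real (coordBox b I J) = volume.real I * volume.real J := by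
  rw [measureReal_def, volume_coordBox b hI hJ, ENNReal.toReal_mul]; rfl

theorem volume_coordBox_ne_top {I J : Set ℝ} (hI : MeasurableSet I) (hJ : MeasurableSet J)
    (hIV : volume I ≠ ⊤) (hJV : volume J ≠ ⊤) : volume (coordBox b I J) ≠ ⊤ := by
  rw [volume_coordBox b hI hJ]
  exact ENNReal.mul_ne_top hIV hJV

theorem volume_real_coordBox_Icc {c d e : ℝ} (hcd : c ≤ d) (he : 0 ≤ e) :
    volume.real (coordBox b (Icc c d) (Icc (-e) e)) = (d - c) * (2 * e) := by
  rw [volume_real_coordBox b measurableSet_Icc measurableSet_Icc,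
    Real.volume_real_Icc_of_le hcd, Real.volume_real_Icc_of_le (by linarith)]
  ring

theorem dist_sq_eq_coord (y z : Plane) :
    dist y z ^ 2 = (b.repr y 0 - b.repr z 0) ^ 2 + (b.repr y 1 - b.repr z 1) ^ 2 := by
  rw [← b.repr.dist_map y z, EuclideanSpace.dist_eq, Real.sq_sqrt (by positivity)]
  simp [Fin.sum_univ_two, Real.dist_eq, sq_abs]

theorem abs_coord_sub_le_dist (y z : Plane) (i : Fin 2) :
    |b.repr y i - b.repr z i| ≤ dist y z := by
  rw [dist_eq_norm, ← b.repr.norm_map]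
  simpa using PiLp.norm_apply_le (b.repr (y - z)) i

end CoordBox

theorem exists_orthonormalBasis_zero_eq {u : Plane} (hu : ‖u‖ = 1) :
    ∃ b : OrthonormalBasis (Fin 2) ℝ Plane, b 0 = u := by
  have h : Orthonormal ℝ (({0} : Set (Fin 2)).domRestrict fun _ => u) :=
    ⟨fun _ => hu, fun _ _ hij => absurd (Subsingleton.elim _ _) hij⟩
  obtain ⟨b, hb⟩ := h.exists_orthonormalBasis_extension_of_card_eq (by simp)
  exact ⟨b, hb 0 rfl⟩

theorem volume_real_closedBall (y : Plane) {r : ℝ} (hr : 0 ≤ r) :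
    volume.real (Metric.closedBall y r) = Real.pi * r ^ 2 := by
  simp [measureReal_def, EuclideanSpace.volume_closedBall_fin_two, hr, Real.pi_pos.le, mul_comm]

/-- The set of the locations that have no point of the configuration `u` within distance `r`. -/
def freeRegion (r : ℝ) (u : ℕ → Plane) : Set Plane :=
  {y | ∀ j, r < dist y (u j)}

theorem mem_freeRegion_iff_pointCount (r : ℝ) (u : ℕ → Plane) (y : Plane) :
    y ∈ freeRegion r u ↔ pointCount u (Metric.closedBall y r) = 0 := by
  rw [pointCount_eq_zero_iff]
  simp [freeRegion, dist_comm]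

theorem measurableSet_mem_freeRegion {α : Type*} [MeasurableSpace α] (r : ℝ)
    {g : α → Plane} {u : ℕ → α → Plane} (hg : Measurable g) (hu : ∀ j, Measurable (u j)) :
    MeasurableSet {a | g a ∈ freeRegion r (fun j => u j a)} := by
  rw [show {a | g a ∈ freeRegion r fun j => u j a} = ⋂ j, {a | r < dist (g a) (u j a)} by
    ext a; simp [freeRegion]]
  exact MeasurableSet.iInter fun j => measurableSet_lt measurable_const (hg.dist (hu j))

theorem measurableSet_freeRegion (r : ℝ) (u : ℕ → Plane) : MeasurableSet (freeRegion r u) :=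
  measurableSet_mem_freeRegion r measurable_id fun _ => measurable_const

theorem abs_indicator_one_sub_le {α : Type*} (s : Set α) (y : α) {c : ℝ} (h0 : 0 ≤ c)
    (h1 : c ≤ 1) : |s.indicator 1 y - c| ≤ 1 := by
  by_cases hy : y ∈ s <;> simp [hy, abs_le] <;> constructor <;> linarith

section SecondMoment

variable {Ω : Type*} [MeasurableSpace Ω] {P : Measure Ω}

theorem integral_abs_le_sqrt_integral_sq [IsProbabilityMeasure P] {g : Ω → ℝ}
    (hg : MemLp g 2 P) : ∫ ω, |g ω| ∂P ≤ √(∫ ω, g ω ^ 2 ∂P) := by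
  refine Real.le_sqrt_of_sq_le ?_
  have hvar := variance_eq_sub hg.abs
  simp only [Pi.pow_apply, Pi.abs_apply, sq_abs] at hvar
  linarith [variance_nonneg |g| P]

variable {α : Type*} [MeasurableSpace α] {f : Ω → α → ℝ} {C : ℝ}

theorem integrable_mul_prod_of_bounded [IsFiniteMeasure P]
    (hf : Measurable fun p : Ω × α => f p.1 p.2) (hC : ∀ ω y, |f ω y| ≤ C)
    (ν : Measure α) [IsFiniteMeasure ν] :
    Integrable (fun p : Ω × (α × α) => f p.1 p.2.1 * f p.1 p.2.2) (P.prod (ν.prod ν)) := by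
  refine Integrable.of_bound (C := C * C) (Measurable.aestronglyMeasurable ?_)
    (Eventually.of_forall fun p => ?_)
  · exact (hf.comp (measurable_fst.prodMk measurable_snd.fst)).mul
      (hf.comp (measurable_fst.prodMk measurable_snd.snd))
  · rw [Real.norm_eq_abs, abs_mul]
    exact mul_le_mul (hC _ _) (hC _ _) (abs_nonneg _) ((abs_nonneg _).trans (hC p.1 p.2.1))

theorem integral_sq_integral_eq_integral_integral_mul [IsFiniteMeasure P]
    (hf : Measurable fun p : Ω × α => f p.1 p.2) (hC : ∀ ω y, |f ω y| ≤ C)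
    (ν : Measure α) [IsFiniteMeasure ν] :
    ∫ ω, (∫ y, f ω y ∂ν) ^ 2 ∂P = ∫ z : α × α, ∫ ω, f ω z.1 * f ω z.2 ∂P ∂(ν.prod ν) := by
  rw [← integral_integral_swap (integrable_mul_prod_of_bounded hf hC ν)]
  simp only [sq, integral_prod_mul]

theorem integral_abs_integral_le_sqrt [IsProbabilityMeasure P]
    (hf : Measurable fun p : Ω × α => f p.1 p.2) (hC : ∀ ω y, |f ω y| ≤ C)
    {N : Set (α × α)} (hN : MeasurableSet N)
    (hcov : ∀ y z, ∫ ω, f ω y * f ω z ∂P ≤ N.indicator 1 (y, z))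
    (ν : Measure α) [IsFiniteMeasure ν] {W : ℝ} (hW : ∀ y, ν.real {z | (y, z) ∈ N} ≤ W) :
    ∫ ω, |∫ y, f ω y ∂ν| ∂P ≤ √(W * ν.real univ) := by
  have hL2 : MemLp (fun ω => ∫ y, f ω y ∂ν) 2 P :=
    MemLp.of_bound hf.stronglyMeasurable.integral_prod_right.aestronglyMeasurable
      (C * ν.real univ)
      (Eventually.of_forall fun ω => norm_integral_le_of_norm_le_const
        (Eventually.of_forall (hC ω)))
  have hNint : Integrable (N.indicator (1 : α × α → ℝ)) (ν.prod ν) :=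
    (integrable_const (1 : ℝ)).indicator hN
  refine (integral_abs_le_sqrt_integral_sq hL2).trans (Real.sqrt_le_sqrt ?_)
  calc ∫ ω, (∫ y, f ω y ∂ν) ^ 2 ∂P
      = ∫ z : α × α, ∫ ω, f ω z.1 * f ω z.2 ∂P ∂(ν.prod ν) :=
        integral_sq_integral_eq_integral_integral_mul hf hC ν
    _ ≤ ∫ z, N.indicator 1 z ∂(ν.prod ν) :=
        integral_mono (integrable_mul_prod_of_bounded hf hC ν).integral_prod_right hNint
          fun z => hcov z.1 z.2
    _ = ∫ y, ν.real {z | (y, z) ∈ N} ∂ν := by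
        rw [integral_prod _ hNint]
        exact integral_congr_ae (Eventually.of_forall fun y =>
          integral_indicator_one (measurable_prodMk_left hN))
    _ ≤ ∫ _, W ∂ν := integral_mono_of_nonneg
        (Eventually.of_forall fun _ => measureReal_nonneg) (integrable_const W)
        (Eventually.of_forall hW)
    _ = W * ν.real univ := by simp [mul_comm]

end SecondMoment

namespace IsPoissonPointProcess

variable {Ω : Type*} [MeasurableSpace Ω] {P : Measure Ω} {U : ℕ → Ω → Plane} {xi r : ℝ}

theorem indepFun_indicator_freeRegion (hU : IsPoissonPointProcess P U xi) {y z : Plane}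
    (hyz : 2 * r < dist y z) (c : ℝ) :
    IndepFun (fun ω => (freeRegion r (fun j => U j ω)).indicator 1 y - c)
      (fun ω => (freeRegion r (fun j => U j ω)).indicator 1 z - c) P := by
  have hcount : ∀ y ω, (freeRegion r (fun j => U j ω)).indicator (1 : Plane → ℝ) y - c =
      ({0} : Set ℕ∞).indicator 1 (pointCount (fun j => U j ω) (Metric.closedBall y r)) - c := by
    intro y ω
    simp only [indicator, mem_freeRegion_iff_pointCount, mem_singleton_iff, Pi.one_apply]
  simp_rw [hcount]
  exact (hU.indepFun_count measurableSet_closedBall measurableSet_closedBall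
    (Metric.closedBall_disjoint_closedBall (by linarith))).comp
    (φ := fun k => ({0} : Set ℕ∞).indicator (1 : ℕ∞ → ℝ) k - c)
    (ψ := fun k => ({0} : Set ℕ∞).indicator (1 : ℕ∞ → ℝ) k - c)
    measurable_from_top measurable_from_top

theorem measurable_indicator_freeRegion (hU : IsPoissonPointProcess P U xi) (r : ℝ) :
    Measurable fun p : Ω × Plane =>
      (freeRegion r (fun j => U j p.1)).indicator (1 : Plane → ℝ) p.2 :=
  measurable_one.indicator (measurableSet_mem_freeRegion r measurable_snd
    fun j => (hU.measurable_point j).comp measurable_fst)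

variable [IsProbabilityMeasure P]

theorem exp_neg_mul_pi_mul_sq_le_one (hU : IsPoissonPointProcess P U xi) (r : ℝ) :
    Real.exp (-(xi * Real.pi * r ^ 2)) ≤ 1 := by
  have := hU.intensity_pos
  exact Real.exp_le_one_iff.2 (neg_nonpos.2 (by positivity))

theorem real_mem_freeRegion (hU : IsPoissonPointProcess P U xi) (hr : 0 ≤ r) (y : Plane) :
    P.real {ω | y ∈ freeRegion r (fun j => U j ω)} = Real.exp (-(xi * Real.pi * r ^ 2)) := by
  simp_rw [mem_freeRegion_iff_pointCount]
  rw [hU.real_count_eq_zero measurableSet_closedBall measure_closedBall_lt_top.ne,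
    volume_real_closedBall y hr, mul_assoc]

theorem integral_indicator_freeRegion_sub (hU : IsPoissonPointProcess P U xi) (hr : 0 ≤ r)
    (y : Plane) :
    ∫ ω, ((freeRegion r (fun j => U j ω)).indicator 1 y - Real.exp (-(xi * Real.pi * r ^ 2))) ∂P =
      0 := by
  have hy : MeasurableSet {ω | y ∈ freeRegion r (fun j => U j ω)} :=
    measurableSet_mem_freeRegion r measurable_const hU.measurable_point
  have hmean := (integral_indicator_one (μ := P) hy).trans (hU.real_mem_freeRegion hr y)
  have hint : Integrable ({ω | y ∈ freeRegion r (fun j => U j ω)}.indicator (1 : Ω → ℝ)) P :=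
    (integrable_const (1 : ℝ)).indicator hy
  have hsub := integral_sub hint (integrable_const (Real.exp (-(xi * Real.pi * r ^ 2))))
  rw [hmean, integral_const, probReal_univ, one_smul, sub_self] at hsub
  exact hsub

theorem integral_indicator_freeRegion_mul_le (hU : IsPoissonPointProcess P U xi)
    (hr : 0 ≤ r) (y z : Plane) :
    ∫ ω, ((freeRegion r (fun j => U j ω)).indicator 1 y - Real.exp (-(xi * Real.pi * r ^ 2))) *
        ((freeRegion r (fun j => U j ω)).indicator 1 z - Real.exp (-(xi * Real.pi * r ^ 2))) ∂P ≤
      {p : Plane × Plane | dist p.1 p.2 ≤ 2 * r}.indicator 1 (y, z) := by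
  by_cases hyz : dist y z ≤ 2 * r
  · have hb : ∀ ω y, ‖(freeRegion r (fun j => U j ω)).indicator 1 y -
        Real.exp (-(xi * Real.pi * r ^ 2))‖ ≤ 1 := fun ω y =>
      abs_indicator_one_sub_le _ y (Real.exp_pos _).le (hU.exp_neg_mul_pi_mul_sq_le_one r)
    rw [indicator_of_mem (show (y, z) ∈ {p : Plane × Plane | dist p.1 p.2 ≤ 2 * r} from hyz)]
    have hle := norm_integral_le_of_norm_le_const (μ := P) (Eventually.of_forall fun ω =>
      (norm_mul _ _).trans_le (mul_le_one₀ (hb ω y) (norm_nonneg _) (hb ω z)))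
    rw [probReal_univ, mul_one] at hle
    exact (le_abs_self _).trans hle
  · have hmeas : ∀ y, AEStronglyMeasurable (fun ω => (freeRegion r (fun j => U j ω)).indicator 1 y -
        Real.exp (-(xi * Real.pi * r ^ 2))) P := fun y =>
      (((hU.measurable_indicator_freeRegion r).comp
        measurable_prodMk_right).sub_const _).aestronglyMeasurable
    have hzero := (hU.indepFun_indicator_freeRegion (not_le.1 hyz)
      (Real.exp (-(xi * Real.pi * r ^ 2)))).integral_fun_mul_eq_mul_integral (hmeas y) (hmeas z)
    rw [hzero, hU.integral_indicator_freeRegion_sub hr y, zero_mul]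
    exact indicator_nonneg (fun _ _ => zero_le_one) _

/-- The indicators of being free at two locations more than `2 * r` apart are independent, so the
variance of the free area of `T` is at most the area of the pairs of close locations. -/
theorem integral_abs_volume_freeRegion_sub_le (hU : IsPoissonPointProcess P U xi)
    (hr : 0 ≤ r) {T : Set Plane} (hVT : volume T ≠ ⊤) {W : ℝ}
    (hW : ∀ y, volume.real (T ∩ Metric.closedBall y (2 * r)) ≤ W) :
    ∫ ω, |volume.real (freeRegion r (fun j => U j ω) ∩ T) -
        Real.exp (-(xi * Real.pi * r ^ 2)) * volume.real T| ∂P ≤ √(W * volume.real T) := by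
  set κ := Real.exp (-(xi * Real.pi * r ^ 2)) with hκ
  have : IsFiniteMeasure (volume.restrict T) := isFiniteMeasure_restrict.2 hVT
  have hclose : ∀ y, (volume.restrict T).real {z | (y, z) ∈ {p : Plane × Plane |
      dist p.1 p.2 ≤ 2 * r}} ≤ W := by
    intro y
    have hball : {z | (y, z) ∈ {p : Plane × Plane | dist p.1 p.2 ≤ 2 * r}} =
        Metric.closedBall y (2 * r) := by ext z; simp [dist_comm]
    rw [hball, measureReal_restrict_apply measurableSet_closedBall, inter_comm]
    exact hW y
  have hmain := integral_abs_integral_le_sqrt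
    ((hU.measurable_indicator_freeRegion r).sub_const κ)
    (fun ω y => abs_indicator_one_sub_le _ y (Real.exp_pos _).le
      (hU.exp_neg_mul_pi_mul_sq_le_one r))
    (measurableSet_le (measurable_fst.dist measurable_snd) measurable_const)
    (hU.integral_indicator_freeRegion_mul_le hr) (volume.restrict T) hclose
  rw [measureReal_restrict_apply_univ] at hmain
  convert hmain using 4 with ω
  have hint : Integrable ((freeRegion r fun j => U j ω).indicator (1 : Plane → ℝ))
      (volume.restrict T) := (integrable_const (1 : ℝ)).indicator (measurableSet_freeRegion r _)
  rw [integral_sub hint (integrable_const _), integral_indicator_one (measurableSet_freeRegion r _),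
    measureReal_restrict_apply (measurableSet_freeRegion r _)]
  simp [mul_comm, hκ]

end IsPoissonPointProcess

/-- The number of points of `x` in `T` that have no point of `u` within distance `r`. -/
noncomputable def freeCount (r : ℝ) (x u : ℕ → Plane) (T : Set Plane) : ℕ∞ :=
  pointCount x (freeRegion r u ∩ T)

theorem freeCount_le_pointCount (r : ℝ) (x u : ℕ → Plane) (T : Set Plane) :
    freeCount r x u T ≤ pointCount x T :=
  pointCount_mono x inter_subset_right

theorem freeCount_empty (r : ℝ) (x u : ℕ → Plane) : freeCount r x u ∅ = 0 := by
  rw [freeCount, inter_empty, pointCount_eq_zero_iff]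
  exact fun i => notMem_empty _

theorem freeCount_union (r : ℝ) (x u : ℕ → Plane) {S T : Set Plane} (h : Disjoint S T) :
    freeCount r x u (S ∪ T) = freeCount r x u S + freeCount r x u T := by
  rw [freeCount, inter_union_distrib_left,
    pointCount_union _ (h.mono inter_subset_right inter_subset_right), freeCount, freeCount]

section Measurable

variable {α : Type*} [MeasurableSpace α] {x u : ℕ → α → Plane} {T : Set Plane}

theorem measurable_freeCount (hx : ∀ i, Measurable (x i)) (hu : ∀ j, Measurable (u j)) (r : ℝ)
    (hT : MeasurableSet T) :
    Measurable fun a => freeCount r (fun i => x i a) (fun j => u j a) T :=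
  measurable_pointCount (B := fun a => freeRegion r (fun j => u j a) ∩ T) fun i =>
    (measurableSet_mem_freeRegion r (hx i) hu).inter (hx i hT)

theorem measurable_volume_freeRegion_inter (hu : ∀ j, Measurable (u j)) (r : ℝ)
    (hT : MeasurableSet T) :
    Measurable fun a => volume.real (freeRegion r (fun j => u j a) ∩ T) := by
  have hs : MeasurableSet {p : α × Plane | p.2 ∈ freeRegion r (fun j => u j p.1) ∧ p.2 ∈ T} :=
    (measurableSet_mem_freeRegion r measurable_snd fun j => (hu j).comp measurable_fst).inter
      (measurable_snd hT)
  exact (measurable_measure_prodMk_left hs).ennreal_toReal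

theorem integrable_abs_volume_freeRegion_sub {P : Measure α} [IsFiniteMeasure P]
    (hu : ∀ j, Measurable (u j)) (r : ℝ) (hT : MeasurableSet T) (hVT : volume T ≠ ⊤)
    (lam μ : ℝ) :
    Integrable (fun a => |lam * volume.real (freeRegion r (fun j => u j a) ∩ T) - μ|) P := by
  have hvol : Integrable (fun a => volume.real (freeRegion r (fun j => u j a) ∩ T)) P :=
    Integrable.of_bound (measurable_volume_freeRegion_inter hu r hT).aestronglyMeasurable
      (volume.real T) (Eventually.of_forall fun a =>
        (Real.norm_of_nonneg measureReal_nonneg).trans_le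
          (measureReal_mono inter_subset_right hVT))
  exact ((hvol.const_mul lam).sub (integrable_const μ)).abs

end Measurable

theorem abs_exp_neg_sub_exp_neg_le {a b : ℝ} (ha : 0 ≤ a) (hb : 0 ≤ b) :
    |Real.exp (-a) - Real.exp (-b)| ≤ |a - b| := by
  have hderiv : ∀ s ∈ Ici (0 : ℝ),
      HasDerivWithinAt (fun s => Real.exp (-s)) (-Real.exp (-s)) (Ici 0) s := fun s _ => by
    simpa using ((hasDerivAt_neg s).exp).hasDerivWithinAt
  simpa using (convex_Ici (0 : ℝ)).norm_image_sub_le_of_norm_hasDerivWithin_le (C := 1) hderiv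
    (fun s hs => by simpa using hs) hb ha

section Independent

variable {Ω α β : Type*} [MeasurableSpace Ω] [MeasurableSpace α] [MeasurableSpace β]
  {P : Measure Ω} [IsProbabilityMeasure P] {Y : Ω → α} {Z : Ω → β}
  {p : α → β → Prop}

theorem measurable_measure_setOf_pair (hY : Measurable Y) (hZ : Measurable Z)
    (hp : MeasurableSet {q : α × β | p q.1 q.2}) : Measurable fun ω' => P {ω | p (Y ω) (Z ω')} :=
  measurable_measure_prodMk_left
    (((hY.comp measurable_snd).prodMk (hZ.comp measurable_fst)) hp)

theorem integrable_real_setOf_pair (hY : Measurable Y) (hZ : Measurable Z)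
    (hp : MeasurableSet {q : α × β | p q.1 q.2}) :
    Integrable (fun ω' => P.real {ω | p (Y ω) (Z ω')}) P :=
  Integrable.of_bound
    (measurable_measure_setOf_pair hY hZ hp).ennreal_toReal.aestronglyMeasurable 1
    (Eventually.of_forall fun _ => (Real.norm_of_nonneg measureReal_nonneg).trans_le
      measureReal_le_one)

theorem real_setOf_pair_eq_integral (hYZ : IndepFun Y Z P) (hY : Measurable Y)
    (hZ : Measurable Z) (hp : MeasurableSet {q : α × β | p q.1 q.2}) :
    P.real {ω | p (Y ω) (Z ω)} = ∫ ω', P.real {ω | p (Y ω) (Z ω')} ∂P := by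
  have := Measure.isProbabilityMeasure_map (μ := P) hY.aemeasurable
  have := Measure.isProbabilityMeasure_map (μ := P) hZ.aemeasurable
  have hlint : P {ω | p (Y ω) (Z ω)} = ∫⁻ ω', P {ω | p (Y ω) (Z ω')} ∂P := by
    have hmap := Measure.map_apply (μ := P) (hY.prodMk hZ) hp
    rw [(indepFun_iff_map_prod_eq_prod_map_map hY.aemeasurable hZ.aemeasurable).1 hYZ,
      Measure.prod_apply_symm hp, lintegral_map (measurable_measure_prodMk_right hp) hZ] at hmap
    exact hmap.symm.trans <|
      lintegral_congr fun ω' => Measure.map_apply hY (measurable_prodMk_right hp)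
  simp only [measureReal_def]
  rw [hlint, integral_toReal (measurable_measure_setOf_pair hY hZ hp).aemeasurable
    (Eventually.of_forall fun _ => measure_lt_top _ _)]

end Independent

namespace IsPoissonPointProcess

variable {Ω : Type*} [MeasurableSpace Ω] {P : Measure Ω} [IsProbabilityMeasure P]
  {X U : ℕ → Ω → Plane} {lam : ℝ}

/-- Given the users, the two counts are independent Poisson variables, so that the error is at most
the mean fluctuation of the parameter of the second one. -/
theorem abs_real_freeCount_lt_inter_sub_le (hX : IsPoissonPointProcess P X lam)
    (hU : ∀ j, Measurable (U j)) (hXU : IndepFun (fun ω i => X i ω) (fun ω j => U j ω) P)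
    (r : ℝ) {B C : Set Plane} (hB : MeasurableSet B) (hC : MeasurableSet C) (hVC : volume C ≠ ⊤)
    (hBC : Disjoint B C) (n : ℕ) {μ : ℝ} (hμ : 0 ≤ μ) :
    |P.real {ω | freeCount r (fun i => X i ω) (fun j => U j ω) B < n ∧
          freeCount r (fun i => X i ω) (fun j => U j ω) C = 0} -
        Real.exp (-μ) * P.real {ω | freeCount r (fun i => X i ω) (fun j => U j ω) B < n}| ≤
      ∫ ω, |lam * volume.real (freeRegion r (fun j => U j ω) ∩ C) - μ| ∂P := by
  have hXm : Measurable fun ω i => X i ω := measurable_pi_lambda _ hX.measurable_point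
  have hUm : Measurable fun ω j => U j ω := measurable_pi_lambda _ hU
  have hfree : ∀ {S : Set Plane}, MeasurableSet S →
      Measurable fun q : (ℕ → Plane) × (ℕ → Plane) => freeCount r q.1 q.2 S :=
    measurable_freeCount (by fun_prop) (by fun_prop) r
  have hB' : MeasurableSet {q : (ℕ → Plane) × (ℕ → Plane) | freeCount r q.1 q.2 B < n} :=
    hfree hB (MeasurableSet.of_discrete (s := Iio (n : ℕ∞)))
  have hBC' : MeasurableSet {q : (ℕ → Plane) × (ℕ → Plane) |
      freeCount r q.1 q.2 B < n ∧ freeCount r q.1 q.2 C = 0} :=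
    hB'.inter (hfree hC (measurableSet_singleton 0))
  have hcond : ∀ ω', P.real {ω | freeCount r (fun i => X i ω) (fun j => U j ω') B < n ∧
      freeCount r (fun i => X i ω) (fun j => U j ω') C = 0} =
        P.real {ω | freeCount r (fun i => X i ω) (fun j => U j ω') B < n} *
          Real.exp (-(lam * volume.real (freeRegion r (fun j => U j ω') ∩ C))) := fun ω' =>
    have hD := measurableSet_freeRegion r fun j => U j ω'
    hX.real_count_lt_inter_count_eq_zero (hD.inter hB) (hD.inter hC)
      (measure_ne_top_of_subset inter_subset_right hVC)
      (hBC.mono inter_subset_right inter_subset_right) n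
  have hintB := integrable_real_setOf_pair (P := P) (p := fun x u => freeCount r x u B < n)
    hXm hUm hB'
  have hintBC := integrable_real_setOf_pair (P := P)
    (p := fun x u => freeCount r x u B < n ∧ freeCount r x u C = 0) hXm hUm hBC'
  rw [real_setOf_pair_eq_integral (p := fun x u => freeCount r x u B < n ∧ freeCount r x u C = 0)
      hXU hXm hUm hBC',
    real_setOf_pair_eq_integral (p := fun x u => freeCount r x u B < n) hXU hXm hUm hB',
    ← integral_const_mul, ← integral_sub hintBC (hintB.const_mul _), ← Real.norm_eq_abs]
  refine norm_integral_le_of_norm_le (integrable_abs_volume_freeRegion_sub hU r hC hVC lam μ)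
    (Eventually.of_forall fun ω' => ?_)
  have := hX.intensity_pos
  rw [hcond ω', mul_comm, ← sub_mul, norm_mul]
  exact (mul_le_of_le_one_right (norm_nonneg _) ((Real.norm_of_nonneg
    measureReal_nonneg).trans_le measureReal_le_one)).trans
    (abs_exp_neg_sub_exp_neg_le (by positivity) hμ)

theorem real_freeCount_eq_zero_le (hX : IsPoissonPointProcess P X lam)
    (hU : ∀ j, Measurable (U j)) (hXU : IndepFun (fun ω i => X i ω) (fun ω j => U j ω) P)
    (r : ℝ) {T : Set Plane} (hT : MeasurableSet T) (hVT : volume T ≠ ⊤) {μ : ℝ} (hμ : 0 ≤ μ) :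
    P.real {ω | freeCount r (fun i => X i ω) (fun j => U j ω) T = 0} ≤
      Real.exp (-μ) + ∫ ω, |lam * volume.real (freeRegion r (fun j => U j ω) ∩ T) - μ| ∂P := by
  have h := hX.abs_real_freeCount_lt_inter_sub_le hU hXU r MeasurableSet.empty hT hVT
    (empty_disjoint T) 1 hμ
  simp only [freeCount_empty, Nat.cast_one, zero_lt_one, true_and, ofPred_true, probReal_univ,
    mul_one] at h
  linarith [le_of_abs_le h]

end IsPoissonPointProcess

theorem mem_upCrossingSet_iff {S : ℝ → ℝ} {δ t : ℝ} :
    t ∈ upCrossingSet S δ ↔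
      0 < t ∧ (∀ᶠ s in 𝓝[<] t, S s < δ) ∧ ∀ᶠ s in 𝓝[>] t, δ ≤ S s := by
  refine and_congr_right fun _ => ⟨?_, ?_⟩
  · rintro ⟨ε, hε, hleft, hright⟩
    exact ⟨mem_of_superset (Ioo_mem_nhdsLT (by linarith)) hleft,
      mem_of_superset (Ioo_mem_nhdsGT (by linarith)) hright⟩
  · rintro ⟨hleft, hright⟩
    obtain ⟨l, hl : l < t, hleft⟩ := mem_nhdsLT_iff_exists_Ioo_subset.1 hleft
    obtain ⟨m, hm : t < m, hright⟩ := mem_nhdsGT_iff_exists_Ioo_subset.1 hright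
    refine ⟨min (t - l) (m - t), lt_min (by linarith) (by linarith), fun s hs => hleft ?_,
      fun s hs => hright ?_⟩
    · exact ⟨by linarith [hs.1, min_le_left (t - l) (m - t)], hs.2⟩
    · exact ⟨hs.1, by linarith [hs.2, min_le_right (t - l) (m - t)]⟩

section OrdConnected

variable {α : Type*} [LinearOrder α] [TopologicalSpace α] [OrderTopology α] {J : Set α}

theorem eventually_mem_or_eventually_notMem_nhdsGT (hJ : J.OrdConnected) (t : α) :
    (∀ᶠ s in 𝓝[>] t, s ∈ J) ∨ ∀ᶠ s in 𝓝[>] t, s ∉ J := by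
  by_cases h : ∃ᶠ s in 𝓝[>] t, s ∈ J
  · left
    obtain ⟨s₀, hs₀, ht₀⟩ := (h.and_eventually self_mem_nhdsWithin).exists
    filter_upwards [Ioo_mem_nhdsGT ht₀] with s hs
    obtain ⟨s₁, hs₁, ht₁⟩ := (h.and_eventually (Ioo_mem_nhdsGT hs.1)).exists
    exact hJ.out hs₁ hs₀ ⟨ht₁.2.le, hs.2.le⟩
  · exact Or.inr (not_frequently.1 h)

theorem eventually_mem_or_eventually_notMem_nhdsLT (hJ : J.OrdConnected) (t : α) :
    (∀ᶠ s in 𝓝[<] t, s ∈ J) ∨ ∀ᶠ s in 𝓝[<] t, s ∉ J :=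
  eventually_mem_or_eventually_notMem_nhdsGT (α := αᵒᵈ) hJ.dual t

end OrdConnected

theorem eventually_exists_or_eventually_not_of_finite {α ι : Type*} {l : Filter α}
    {J : ι → Set α} {F : Set ι} (hF : F.Finite)
    (h : ∀ i ∈ F, (∀ᶠ s in l, s ∈ J i) ∨ ∀ᶠ s in l, s ∉ J i) :
    (∀ᶠ s in l, ∃ i ∈ F, s ∈ J i) ∨ ∀ᶠ s in l, ¬∃ i ∈ F, s ∈ J i := by
  by_cases hmem : ∃ i ∈ F, ∀ᶠ s in l, s ∈ J i
  · obtain ⟨i, hi, hs⟩ := hmem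
    exact Or.inl (hs.mono fun s hs => ⟨i, hi, hs⟩)
  · push Not at hmem ⊢
    exact Or.inr ((eventually_all_finite hF).2 fun i hi =>
      (h i hi).resolve_left (not_eventually.2 (hmem i hi)))

/-- The path `S` reaches the level `δ` on a locally finite union of intervals. -/
structure HasLocallyFiniteLevelSet {ι : Type*} (S : ℝ → ℝ) (δ : ℝ) (J : ι → Set ℝ) : Prop where
  ordConnected : ∀ i, (J i).OrdConnected
  exists_finite : ∀ T : ℝ, ∃ F : Set ι, F.Finite ∧ ∀ t, |t| < T → (δ ≤ S t ↔ ∃ i ∈ F, t ∈ J i)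

namespace HasLocallyFiniteLevelSet

variable {ι : Type*} {S : ℝ → ℝ} {δ : ℝ} {J : ι → Set ℝ}

theorem eventually_le_or_eventually_lt (h : HasLocallyFiniteLevelSet S δ J) {t : ℝ}
    {l : Filter ℝ} (hl : l ≤ 𝓝 t) (hJ : ∀ i, (∀ᶠ s in l, s ∈ J i) ∨ ∀ᶠ s in l, s ∉ J i) :
    (∀ᶠ s in l, δ ≤ S s) ∨ ∀ᶠ s in l, S s < δ := by
  obtain ⟨F, hF, hS⟩ := h.exists_finite (|t| + 1)
  have hbdd : ∀ᶠ s in l, |s| < |t| + 1 :=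
    (continuous_abs.continuousAt.eventually_lt_const (lt_add_one |t|)).filter_mono hl
  refine (eventually_exists_or_eventually_not_of_finite hF fun i _ => hJ i).imp
    (fun hev => ?_) fun hev => ?_
  · filter_upwards [hev, hbdd] with s hs hst using (hS s hst).2 hs
  · filter_upwards [hev, hbdd] with s hs hst using not_le.1 fun hle => hs ((hS s hst).1 hle)

theorem eventually_nhdsGT (h : HasLocallyFiniteLevelSet S δ J) (t : ℝ) :
    (∀ᶠ s in 𝓝[>] t, δ ≤ S s) ∨ ∀ᶠ s in 𝓝[>] t, S s < δ :=
  h.eventually_le_or_eventually_lt nhdsWithin_le_nhds fun i =>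
    eventually_mem_or_eventually_notMem_nhdsGT (h.ordConnected i) t

theorem eventually_nhdsLT (h : HasLocallyFiniteLevelSet S δ J) (t : ℝ) :
    (∀ᶠ s in 𝓝[<] t, δ ≤ S s) ∨ ∀ᶠ s in 𝓝[<] t, S s < δ :=
  h.eventually_le_or_eventually_lt nhdsWithin_le_nhds fun i =>
    eventually_mem_or_eventually_notMem_nhdsLT (h.ordConnected i) t

/-- An interval of the level set that accumulates at an up-crossing from the right starts there,
and it determines the up-crossing. -/
theorem finite_upCrossingSet_inter_Iic (h : HasLocallyFiniteLevelSet S δ J) (T : ℝ) :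
    (upCrossingSet S δ ∩ Iic T).Finite := by
  obtain ⟨F, hF, hS⟩ := h.exists_finite (|T| + 1)
  refine (hF.biUnion (t := fun i => {t | IsGLB (J i) t}) fun i _ =>
    (show ({t | IsGLB (J i) t} : Set ℝ).Subsingleton from
      fun a ha c hc => ha.unique hc).finite).subset ?_
  rintro t ⟨ht, htT⟩
  obtain ⟨ht0, hleft, hright⟩ := mem_upCrossingSet_iff.1 ht
  have hbdd : ∀ᶠ s in 𝓝 t, |s| < |T| + 1 :=
    continuous_abs.continuousAt.eventually_lt_const <| by
      rw [abs_of_pos ht0]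
      exact (le_trans htT (le_abs_self T)).trans_lt (lt_add_one _)
  obtain ⟨i, hi, hfreq⟩ : ∃ i ∈ F, ∃ᶠ s in 𝓝[>] t, s ∈ J i := by
    by_contra! hout
    obtain ⟨s, hs, hle, hsT⟩ := (((eventually_all_finite hF).2 hout).and
      (hright.and (hbdd.filter_mono nhdsWithin_le_nhds))).exists
    obtain ⟨i, hi, hsi⟩ := (hS s hsT).1 hle
    exact hs i hi hsi
  refine mem_biUnion hi ⟨fun s hs => ?_, fun c hc => ?_⟩
  · by_contra! hst
    obtain ⟨s₁, hs₁, hts₁⟩ := (hfreq.and_eventually self_mem_nhdsWithin).exists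
    obtain ⟨s₂, hlt, hs₂T, hs₂⟩ := (hleft.and ((hbdd.filter_mono nhdsWithin_le_nhds).and
      (Ioo_mem_nhdsLT hst))).exists
    have hs₂J : s₂ ∈ J i :=
      (h.ordConnected i).out hs hs₁ ⟨hs₂.1.le, hs₂.2.le.trans (le_of_lt hts₁)⟩
    exact hlt.not_ge ((hS s₂ hs₂T).2 ⟨i, hi, hs₂J⟩)
  · by_contra! hct
    obtain ⟨s, hs, hsc⟩ := (hfreq.and_eventually (Ioo_mem_nhdsGT hct)).exists
    exact hsc.2.not_ge (hc hs)

theorem exists_mem_upCrossingSet (h : HasLocallyFiniteLevelSet S δ J) {t₀ t₁ : ℝ} (h0 : 0 < t₀)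
    (ht : t₀ ≤ t₁) (hlow : ∀ᶠ s in 𝓝[<] t₀, S s < δ) (hhigh : ∀ᶠ s in 𝓝[<] t₁, δ ≤ S s) :
    ∃ t ∈ upCrossingSet S δ, t₀ ≤ t := by
  set Q : Set ℝ := {t | t ∈ Icc t₀ t₁ ∧ ∀ᶠ s in 𝓝[<] t, S s < δ}
  have hQ₀ : t₀ ∈ Q := ⟨⟨le_rfl, ht⟩, hlow⟩
  have hbdd : BddAbove Q := ⟨t₁, fun t ht => ht.1.2⟩
  set q := sSup Q
  have hq₀ : t₀ ≤ q := le_csSup hbdd hQ₀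
  have hleft : ∀ᶠ s in 𝓝[<] q, S s < δ := by
    refine (h.eventually_nhdsLT q).resolve_left fun hge => ?_
    obtain ⟨a, ha : a < q, hge⟩ := mem_nhdsLT_iff_exists_Ioo_subset.1 hge
    obtain ⟨c, hcQ, hac⟩ := exists_lt_of_lt_csSup ⟨t₀, hQ₀⟩ ha
    obtain ⟨s, hlt, hs⟩ := (hcQ.2.and (Ioo_mem_nhdsLT hac)).exists
    exact hlt.not_ge (hge ⟨hs.1, hs.2.trans_le (le_csSup hbdd hcQ)⟩)
  have hq₁ : q < t₁ := by
    refine lt_of_le_of_ne (csSup_le ⟨t₀, hQ₀⟩ fun t ht => ht.1.2) fun heq => ?_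
    rw [heq] at hleft
    obtain ⟨s, hlt, hge⟩ := (hleft.and hhigh).exists
    exact hlt.not_ge hge
  refine ⟨q, mem_upCrossingSet_iff.2 ⟨h0.trans_le hq₀, hleft, ?_⟩, hq₀⟩
  refine (h.eventually_nhdsGT q).resolve_right fun hlt => ?_
  obtain ⟨c, hc : q < c, hlt⟩ := mem_nhdsGT_iff_exists_Ioo_subset.1 hlt
  obtain ⟨c', hqc', hc'⟩ := exists_between (lt_min hc hq₁)
  obtain ⟨hc'c, hc't⟩ := lt_min_iff.1 hc'
  have hc'Q : c' ∈ Q := by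
    refine ⟨⟨hq₀.trans hqc'.le, hc't.le⟩, ?_⟩
    filter_upwards [Ioo_mem_nhdsLT hqc'] with s hs using hlt ⟨hs.1, hs.2.trans hc'c⟩
  exact hqc'.not_ge (le_csSup hbdd hc'Q)

theorem infinite_upCrossingSet (h : HasLocallyFiniteLevelSet S δ J)
    (hlow : ∃ᶠ t in atTop, ∀ᶠ s in 𝓝[<] t, S s < δ)
    (hhigh : ∃ᶠ t in atTop, ∀ᶠ s in 𝓝[<] t, δ ≤ S s) : (upCrossingSet S δ).Infinite := by
  refine infinite_of_forall_exists_gt fun T => ?_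
  obtain ⟨t₀, ht₀, hlow⟩ := frequently_atTop'.1 hlow (max T 0)
  obtain ⟨t₁, ht₁, hhigh⟩ := frequently_atTop.1 hhigh t₀
  obtain ⟨hT, h0⟩ := max_lt_iff.1 ht₀
  obtain ⟨t, ht, ht₀t⟩ := h.exists_mem_upCrossingSet h0 ht₁ hlow hhigh
  exact ⟨t, ht, hT.trans_le ht₀t⟩

end HasLocallyFiniteLevelSet

theorem eventually_inter_Iic_subset {W : Set ℝ} (hW : ∀ t, (W ∩ Iic t).Finite) (T : ℝ) :
    ∀ᶠ s in 𝓝[≥] T, W ∩ Iic s ⊆ W ∩ Iic T := by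
  have hbelow : ∀ᶠ s in 𝓝[≥] T, ∀ a ∈ (W ∩ Iic (T + 1)) \ Iic T, s < a :=
    (eventually_all_finite (hW (T + 1)).sdiff).2 fun a ha =>
      mem_nhdsWithin_of_mem_nhds (Iio_mem_nhds (not_le.1 ha.2))
  have hbdd : ∀ᶠ s in 𝓝[≥] T, s < T + 1 :=
    mem_nhdsWithin_of_mem_nhds (Iio_mem_nhds (lt_add_one T))
  filter_upwards [hbelow, hbdd] with s hs hsT a ha
  refine ⟨ha.1, ?_⟩
  by_contra haT
  exact (hs a ⟨⟨ha.1, ha.2.trans hsT.le⟩, haT⟩).not_ge ha.2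

theorem nthUpCrossing_le_iff {S : ℝ → ℝ} {δ : ℝ} (hinf : (upCrossingSet S δ).Infinite)
    (hfin : ∀ t, (upCrossingSet S δ ∩ Iic t).Finite) {n : ℕ} {t : ℝ} (ht : 0 ≤ t) :
    nthUpCrossing S δ n ≤ t ↔ (n : ℕ∞) ≤ (upCrossingSet S δ ∩ Iic t).encard := by
  set W := upCrossingSet S δ
  set Q : Set ℝ := {t | 0 ≤ t ∧ (n : ℕ∞) ≤ (W ∩ Iic t).encard}
  have hbdd : BddBelow Q := ⟨0, fun s hs => hs.1⟩
  have hne : Q.Nonempty := by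
    obtain ⟨F, hFW, hF⟩ := hinf.exists_subset_card_eq n
    obtain ⟨c, hc⟩ := F.bddAbove
    refine ⟨max c 0, le_max_right _ _, ?_⟩
    rw [← hF, ← encard_coe_eq_coe_finsetCard]
    exact encard_le_encard fun s hs => ⟨hFW hs, (hc hs).trans (le_max_left _ _)⟩
  change sInf Q ≤ t ↔ _
  refine ⟨fun h => ?_, fun h => csInf_le hbdd ⟨ht, h⟩⟩
  obtain ⟨c, hc : sInf Q < c, hsub⟩ :=
    mem_nhdsGE_iff_exists_Ico_subset.1 (eventually_inter_Iic_subset hfin (sInf Q))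
  obtain ⟨q, hqQ, hq⟩ := exists_lt_of_csInf_lt hne hc
  calc (n : ℕ∞) ≤ (W ∩ Iic q).encard := hqQ.2
    _ ≤ (W ∩ Iic (sInf Q)).encard := encard_le_encard (hsub ⟨csInf_le hbdd hqQ, hq⟩)
    _ ≤ (W ∩ Iic t).encard := encard_le_encard (inter_subset_inter_right W (Iic_subset_Iic.2 h))

theorem monotone_nthUpCrossing {S : ℝ → ℝ} {δ : ℝ} (hinf : (upCrossingSet S δ).Infinite)
    (hfin : ∀ t, (upCrossingSet S δ ∩ Iic t).Finite) : Monotone (nthUpCrossing S δ) := by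
  intro n m hnm
  have hm : 0 ≤ nthUpCrossing S δ m := Real.sInf_nonneg fun _ ht => ht.1
  rw [nthUpCrossing_le_iff hinf hfin hm]
  exact (Nat.cast_le.2 hnm).trans ((nthUpCrossing_le_iff hinf hfin hm).1 le_rfl)

theorem encard_upCrossingSet_inter_Iic_eq {ι : Type*} {S : ℝ → ℝ} {δ T T' : ℝ} {G : Set ι}
    {α β : ι → ℝ} (hG : G.Finite) (hT : T < T')
    (hS : ∀ t ∈ Ioo 0 T', δ ≤ S t ↔ ∃ i ∈ G, t ∈ Icc (α i) (β i))
    (hα : ∀ i ∈ G, α i ∈ Ioc 0 T) (hαβ : ∀ i ∈ G, α i < β i)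
    (hdisj : G.PairwiseDisjoint fun i => Icc (α i) (β i)) :
    (upCrossingSet S δ ∩ Iic T).encard = G.encard := by
  have hinj : InjOn α G := fun i hi j hj hij => hdisj.elim_set hi hj (α i)
    ⟨le_rfl, (hαβ i hi).le⟩ ⟨hij.ge, hij.trans_le (hαβ j hj).le⟩
  suffices himage : upCrossingSet S δ ∩ Iic T = α '' G by rw [himage, hinj.encard_image]
  have hclosed (F : Set ι) (hF : F.Finite) {t : ℝ} (ht : ∀ i ∈ F, t ∉ Icc (α i) (β i)) :
      ∀ᶠ s in 𝓝 t, ∀ i ∈ F, s ∉ Icc (α i) (β i) :=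
    (eventually_all_finite hF).2 fun i hi => isClosed_Icc.isOpen_compl.mem_nhds (ht i hi)
  ext t
  rw [mem_inter_iff, mem_upCrossingSet_iff, mem_Iic]
  constructor
  · rintro ⟨⟨ht0, hleft, hright⟩, htT⟩
    have hnear : ∀ᶠ s in 𝓝 t, s ∈ Ioo 0 T' := Ioo_mem_nhds ht0 (htT.trans_lt hT)
    obtain ⟨i, hi, hit⟩ : ∃ i ∈ G, t ∈ Icc (α i) (β i) := by
      by_contra! hout
      obtain ⟨s, hge, hs, hs'⟩ := (hright.and
        ((hnear.and (hclosed G hG hout)).filter_mono nhdsWithin_le_nhds)).exists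
      obtain ⟨i, hi, his⟩ := (hS s hs).1 hge
      exact hs' i hi his
    refine ⟨i, hi, hit.1.eq_of_not_lt fun hlt => ?_⟩
    obtain ⟨s, hSs, hs, hαs⟩ := (hleft.and
      ((hnear.filter_mono nhdsWithin_le_nhds).and (Ioo_mem_nhdsLT hlt))).exists
    exact hSs.not_ge ((hS s hs).2 ⟨i, hi, hαs.1.le, hαs.2.le.trans hit.2⟩)
  · rintro ⟨i, hi, rfl⟩
    have hnear : ∀ᶠ s in 𝓝 (α i), s ∈ Ioo 0 T' :=
      Ioo_mem_nhds (hα i hi).1 ((hα i hi).2.trans_lt hT)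
    refine ⟨⟨(hα i hi).1, ?_, ?_⟩, (hα i hi).2⟩
    · have hother : ∀ j ∈ G \ {i}, α i ∉ Icc (α j) (β j) := fun j hj hij =>
        hj.2 (hdisj.elim_set hj.1 hi (α i) hij ⟨le_rfl, (hαβ i hi).le⟩)
      filter_upwards [(hnear.and (hclosed _ hG.sdiff hother)).filter_mono nhdsWithin_le_nhds,
        self_mem_nhdsWithin] with s hs hsα
      refine not_le.1 fun hge => ?_
      obtain ⟨j, hj, hjs⟩ := (hS s hs.1).1 hge
      exact hs.2 j ⟨hj, fun hji => (hji ▸ hjs.1).not_gt hsα⟩ hjs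
    · filter_upwards [hnear.filter_mono nhdsWithin_le_nhds, Ioo_mem_nhdsGT (hαβ i hi)]
        with s hs hsαβ using (hS s hs).2 ⟨i, hi, hsαβ.1.le, hsαβ.2.le⟩

section ClosestNode

variable {E : Type*} [NormedAddCommGroup E] [InnerProductSpace ℝ E]

theorem dist_le_dist_iff_inner (a b y : E) :
    dist y a ≤ dist y b ↔ 2 * inner ℝ (b - a) y ≤ ‖b‖ ^ 2 - ‖a‖ ^ 2 := by
  rw [← sq_le_sq₀ dist_nonneg dist_nonneg, dist_eq_norm, dist_eq_norm, norm_sub_sq_real,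
    norm_sub_sq_real, inner_sub_left, real_inner_comm a y, real_inner_comm b y]
  constructor <;> intro h <;> linarith

theorem convex_setOf_dist_le_dist (a b : E) : Convex ℝ {y | dist y a ≤ dist y b} := by
  simp_rw [dist_le_dist_iff_inner]
  exact convex_halfSpace_le ((2 : ℝ) • innerₛₗ ℝ (b - a)).isLinear _

theorem convex_setOf_dist_lt_dist (a b : E) : Convex ℝ {y | dist y a < dist y b} := by
  simp_rw [← not_le, dist_le_dist_iff_inner, not_le]
  exact convex_halfSpace_gt ((2 : ℝ) • innerₛₗ ℝ (a - b)).isLinear _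

end ClosestNode

/-- Every bounded region contains finitely many points of the configuration. -/
def IsLocallyFiniteConfig (x : ℕ → Plane) : Prop :=
  ∀ (y : Plane) (R : ℝ), {i | x i ∈ Metric.closedBall y R}.Finite

namespace IsLocallyFiniteConfig

variable {x : ℕ → Plane}

theorem mem_voronoiCell_closestIndex (hx : IsLocallyFiniteConfig x) (y : Plane) :
    y ∈ voronoiCell x (closestIndex x y) := by
  suffices h : {i | y ∈ voronoiCell x i}.Nonempty from Nat.sInf_mem h
  have h0 : x 0 ∈ Metric.closedBall y (dist y (x 0)) := by simp [dist_comm]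
  obtain ⟨i, -, hmin⟩ := exists_min_image {i | x i ∈ Metric.closedBall y (dist y (x 0))}
    (fun i => dist y (x i)) (hx y _) ⟨0, h0⟩
  refine ⟨i, fun j => ?_⟩
  by_cases hj : x j ∈ Metric.closedBall y (dist y (x 0))
  · exact hmin j hj
  · rw [Metric.mem_closedBall, not_le, dist_comm (x j)] at hj
    exact (hmin 0 h0).trans hj.le

theorem closestIndex_eq_iff (hx : IsLocallyFiniteConfig x) {y : Plane} {i : ℕ} :
    closestIndex x y = i ↔
      (∀ j, dist y (x i) ≤ dist y (x j)) ∧ ∀ j < i, dist y (x i) < dist y (x j) := by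
  constructor
  · rintro rfl
    have h := hx.mem_voronoiCell_closestIndex y
    refine ⟨h, fun j hj => not_le.1 fun hle => ?_⟩
    exact Nat.notMem_of_lt_sInf hj fun k => hle.trans (h k)
  · rintro ⟨hle, hlt⟩
    refine le_antisymm (Nat.sInf_le hle) (not_lt.1 fun hi => ?_)
    exact (hlt _ hi).not_ge (hx.mem_voronoiCell_closestIndex y i)

theorem convex_setOf_closestIndex_eq (hx : IsLocallyFiniteConfig x) (i : ℕ) :
    Convex ℝ {y | closestIndex x y = i} := by
  simp_rw [hx.closestIndex_eq_iff, ofPred_and, ofPred_forall]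
  exact (convex_iInter fun j => convex_setOf_dist_le_dist _ _).inter
    (convex_iInter₂ fun j _ => convex_setOf_dist_lt_dist _ _)

end IsLocallyFiniteConfig

namespace NetworkParams

/-- Positive parameters and a unit direction of motion, with an arbitrary positive path loss
exponent; the intensities are unconstrained. -/
structure WeaklyAdmissible (M : NetworkParams) : Prop where
  v_pos : 0 < M.v
  norm_dir : ‖M.dir‖ = 1
  p_pos : 0 < M.p
  w_pos : 0 < M.w
  beta_pos : 0 < M.beta
  a_pos : 0 < M.a
  gam_pos : 0 < M.gam

theorem Admissible.weaklyAdmissible {M : NetworkParams} (hM : M.Admissible) :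
    M.WeaklyAdmissible where
  v_pos := hM.v_pos
  norm_dir := hM.norm_dir
  p_pos := hM.p_pos
  w_pos := hM.w_pos
  beta_pos := two_pos.trans hM.two_lt_beta
  a_pos := hM.a_pos
  gam_pos := hM.gam_pos

section Position

variable (M : NetworkParams)

theorem continuous_position : Continuous M.position := by
  unfold position; fun_prop

theorem ordConnected_preimage_position {s : Set Plane} (hs : Convex ℝ s) :
    (M.position ⁻¹' s).OrdConnected := by
  refine (hs.is_linear_preimage ⟨fun t t' => ?_, fun c t => ?_⟩).ordConnected
  · rw [position, mul_add, add_smul]; rfl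
  · rw [position, position, smul_smul, smul_eq_mul, mul_left_comm]

variable {M}

theorem dist_position_position (hM : M.WeaklyAdmissible) (s t : ℝ) :
    dist (M.position s) (M.position t) = M.v * |s - t| := by
  rw [position, position, dist_eq_norm, ← sub_smul, norm_smul, hM.norm_dir, mul_one, ← mul_sub,
    Real.norm_eq_abs, abs_mul, abs_of_pos hM.v_pos]

variable {b : OrthonormalBasis (Fin 2) ℝ Plane}

theorem coord_position (hb : b 0 = M.dir) (t : ℝ) :
    b.repr (M.position t) 0 = M.v * t ∧ b.repr (M.position t) 1 = 0 := by
  simp [position, ← hb]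

theorem dist_position_sq (hb : b 0 = M.dir) (t : ℝ) (y : Plane) :
    dist (M.position t) y ^ 2 = (M.v * t - b.repr y 0) ^ 2 + b.repr y 1 ^ 2 := by
  rw [dist_sq_eq_coord b, (coord_position hb t).1, (coord_position hb t).2]
  ring

theorem position_ne (hb : b 0 = M.dir) {y : Plane} (hy : b.repr y 1 ≠ 0) (t : ℝ) :
    M.position t ≠ y := by
  rintro rfl
  exact hy (coord_position hb t).2

theorem mem_coordBox_of_dist_position_le (hb : b 0 = M.dir) {t R : ℝ} {y : Plane}
    (h : dist (M.position t) y ≤ R) :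
    y ∈ coordBox b (Icc (M.v * t - R) (M.v * t + R)) (Icc (-R) R) := by
  have h0 := abs_le.1 ((abs_coord_sub_le_dist b (M.position t) y 0).trans h)
  have h1 := abs_le.1 ((abs_coord_sub_le_dist b (M.position t) y 1).trans h)
  rw [(coord_position hb t).1] at h0
  rw [(coord_position hb t).2] at h1
  exact ⟨⟨by linarith, by linarith⟩, ⟨by linarith, by linarith⟩⟩

end Position

section Radius

variable {M : NetworkParams} (hM : M.WeaklyAdmissible) {δ : ℝ}
include hM

theorem exp_div_sub_one_pos (hδ : 0 < δ) : 0 < Real.exp (δ / M.a) - 1 :=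
  sub_pos.2 (Real.one_lt_exp_iff.2 (div_pos hδ hM.a_pos))

theorem coverageRadius_pos {s : ℝ} (hs : 0 < s) : 0 < M.coverageRadius s :=
  Real.rpow_pos_of_pos (div_pos hM.p_pos (mul_pos hM.w_pos hs)) _

theorem rateRadius_pos (hδ : 0 < δ) : 0 < M.rateRadius δ :=
  coverageRadius_pos hM (exp_div_sub_one_pos hM hδ)

theorem coverageRadius_anti {s s' : ℝ} (hs : 0 < s) (h : s ≤ s') :
    M.coverageRadius s' ≤ M.coverageRadius s := by
  have := hM.w_pos
  have := hM.p_pos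
  have := hM.beta_pos
  have := hs.trans_le h
  unfold coverageRadius
  gcongr

theorem rateRadius_anti {δ' : ℝ} (hδ : 0 < δ) (h : δ ≤ δ') :
    M.rateRadius δ' ≤ M.rateRadius δ := by
  have := hM.a_pos
  refine coverageRadius_anti hM (exp_div_sub_one_pos hM hδ) ?_
  gcongr

theorem le_shannonRate_iff (hδ : 0 < δ) {L : ℝ} (hL : 0 < L) :
    δ ≤ M.a * Real.log (1 + M.p * L ^ (-M.beta) / M.w) ↔ L ≤ M.rateRadius δ := by
  have hp := hM.p_pos
  have hw := hM.w_pos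
  have hE := exp_div_sub_one_pos hM hδ
  have hLβ : 0 < L ^ M.beta := Real.rpow_pos_of_pos hL _
  rw [← div_le_iff₀' hM.a_pos, Real.le_log_iff_exp_le (by positivity), ← sub_le_iff_le_add',
    rateRadius, coverageRadius, one_div, Real.le_rpow_inv_iff_of_pos hL.le (by positivity)
    hM.beta_pos, Real.rpow_neg hL.le, le_div_iff₀ hw, ← div_eq_mul_inv, le_div_iff₀ hLβ,
    le_div_iff₀ (by positivity), mul_comm (L ^ M.beta), mul_comm M.w]

end Radius

section SharedRate

variable {M : NetworkParams} {x u : ℕ → Plane} {δ t : ℝ}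

/-- The number of users in the disc of coverage of the node `i`. -/
noncomputable def nodeUsers (M : NetworkParams) (x u : ℕ → Plane) (i : ℕ) : ℕ :=
  (pointCount u (Metric.closedBall (x i) (M.coverageRadius M.gam))).toNat

theorem nodeUsers_eq_zero_iff (hu : IsLocallyFiniteConfig u) (i : ℕ) :
    M.nodeUsers x u i = 0 ↔ x i ∈ freeRegion (M.coverageRadius M.gam) u := by
  rw [mem_freeRegion_iff_pointCount, nodeUsers, ENat.toNat_eq_zero]
  exact or_iff_left (encard_ne_top_iff.2 (hu _ _))

theorem le_lowerSharedRate_iff (hM : M.WeaklyAdmissible) (hx : IsLocallyFiniteConfig x)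
    (hδ : 0 < δ) {i : ℕ} (hi : closestIndex x (M.position t) = i) (hne : M.position t ≠ x i) :
    δ ≤ M.lowerSharedRate x u t ↔ dist (M.position t) (x i) ≤ M.coverageRadius M.gam ∧
      dist (M.position t) (x i) ≤ M.rateRadius (δ * (M.nodeUsers x u i + 1)) := by
  have hcell := hx.mem_voronoiCell_closestIndex (M.position t)
  rw [hi] at hcell
  have hN : (0 : ℝ) < M.nodeUsers x u i + 1 := by positivity
  by_cases hL : dist (M.position t) (x i) ≤ M.coverageRadius M.gam
  · have hU : M.upperSharingNumber x u t = M.nodeUsers x u i := by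
      rw [upperSharingNumber, hi, if_pos ⟨hcell, hL⟩, closestNode, hi, nodeUsers]
    rw [lowerSharedRate, hU, shannonRate, distClosest, closestNode, hi, if_pos hL, snr,
      distClosest, closestNode, hi, mul_one_div, le_div_iff₀ hN,
      le_shannonRate_iff hM (mul_pos hδ hN) (dist_pos.2 hne)]
    exact (and_iff_right hL).symm
  · rw [lowerSharedRate, shannonRate, distClosest, closestNode, hi, if_neg hL, zero_mul]
    exact iff_of_false hδ.not_ge fun h => hL h.1

theorem hasLocallyFiniteLevelSet_lowerSharedRate (hM : M.WeaklyAdmissible)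
    (hx : IsLocallyFiniteConfig x) (hpath : ∀ i t, M.position t ≠ x i) (hδ : 0 < δ) :
    HasLocallyFiniteLevelSet (M.lowerSharedRate x u) δ
      fun i => {t | closestIndex x (M.position t) = i ∧ δ ≤ M.lowerSharedRate x u t} where
  ordConnected i := by
    have hset : {t | closestIndex x (M.position t) = i ∧ δ ≤ M.lowerSharedRate x u t} =
        M.position ⁻¹' ({y | closestIndex x y = i} ∩
          (Metric.closedBall (x i) (M.coverageRadius M.gam) ∩
            Metric.closedBall (x i) (M.rateRadius (δ * (M.nodeUsers x u i + 1))))) :=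
      ext fun t => and_congr_right fun hi => le_lowerSharedRate_iff hM hx hδ hi (hpath i t)
    rw [hset]
    exact M.ordConnected_preimage_position ((hx.convex_setOf_closestIndex_eq i).inter
      ((convex_closedBall _ _).inter (convex_closedBall _ _)))
  exists_finite T := by
    refine ⟨_, hx (M.position 0) (M.v * T + M.coverageRadius M.gam), fun t ht =>
      ⟨fun h => ⟨_, ?_, rfl, h⟩, fun ⟨_, _, _, h⟩ => h⟩⟩
    have hnear := ((le_lowerSharedRate_iff hM hx hδ rfl (hpath _ t)).1 h).1
    have hstart : dist (M.position t) (M.position 0) ≤ M.v * T := by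
      rw [dist_position_position hM, sub_zero]
      exact mul_le_mul_of_nonneg_left ht.le hM.v_pos.le
    exact (dist_triangle_left _ _ (M.position t)).trans (by linarith)

theorem eventually_lowerSharedRate_lt {R : ℝ} (hδ : 0 < δ) (hR : M.coverageRadius M.gam < R)
    (h : ∀ i, x i ∉ Metric.closedBall (M.position t) R) :
    ∀ᶠ s in 𝓝 t, M.lowerSharedRate x u s < δ := by
  have hball := (M.continuous_position.tendsto t).eventually
    (Metric.ball_mem_nhds (M.position t) (sub_pos.2 hR))
  filter_upwards [hball] with s (hs : dist _ _ < _)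
  have hclosest := h (closestIndex x (M.position s))
  rw [Metric.mem_closedBall, not_le] at hclosest
  have hfar := dist_triangle_left (x (closestIndex x (M.position s))) (M.position t) (M.position s)
  rw [lowerSharedRate, shannonRate, distClosest, closestNode, if_neg (by linarith), zero_mul]
  exact hδ

theorem eventually_le_lowerSharedRate (hM : M.WeaklyAdmissible) (hx : IsLocallyFiniteConfig x)
    (hu : IsLocallyFiniteConfig u) (hpath : ∀ i t, M.position t ≠ x i) {ε : ℝ} (hδ : 0 < δ)
    (hε : 2 * ε ≤ M.coverageRadius M.gam) (hε' : 2 * ε ≤ M.rateRadius δ) {i : ℕ}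
    (hi : x i ∈ freeRegion (M.coverageRadius M.gam + 4 * ε) u)
    (hti : dist (M.position t) (x i) < 2 * ε) :
    ∀ᶠ s in 𝓝 t, δ ≤ M.lowerSharedRate x u s := by
  have hcont : Continuous fun s => dist (M.position s) (x i) :=
    M.continuous_position.dist continuous_const
  filter_upwards [hcont.continuousAt.eventually_lt_const hti] with s hs
  have hle := hx.mem_voronoiCell_closestIndex (M.position s) i
  rw [le_lowerSharedRate_iff hM hx hδ rfl (hpath _ s)]
  set j := closestIndex x (M.position s)
  have hfree : x j ∈ freeRegion (M.coverageRadius M.gam) u := fun k => by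
    linarith [hi k, dist_triangle (x i) (x j) (u k),
      dist_triangle_left (x i) (x j) (M.position s)]
  rw [(nodeUsers_eq_zero_iff hu j).2 hfree, Nat.cast_zero, zero_add, mul_one]
  constructor <;> linarith

end SharedRate

section PathTube

variable (b : OrthonormalBasis (Fin 2) ℝ Plane)

/-- The tube of radius `ρ` around the path of the mobile user, between the travelled distances
`s` and `ℓ`. -/
def pathTube (s ℓ ρ : ℝ) : Set Plane :=
  coordBox b (Ioc s ℓ) (Ioo (-ρ) ρ)

theorem measurableSet_pathTube (s ℓ ρ : ℝ) : MeasurableSet (pathTube b s ℓ ρ) :=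
  measurableSet_coordBox b measurableSet_Ioc measurableSet_Ioo

theorem volume_pathTube_ne_top (s ℓ ρ : ℝ) : volume (pathTube b s ℓ ρ) ≠ ⊤ :=
  volume_coordBox_ne_top b measurableSet_Ioc measurableSet_Ioo measure_Ioc_lt_top.ne
    measure_Ioo_lt_top.ne

theorem volume_real_pathTube {s ℓ ρ : ℝ} (h : s ≤ ℓ) (hρ : 0 ≤ ρ) :
    volume.real (pathTube b s ℓ ρ) = (ℓ - s) * (2 * ρ) := by
  rw [pathTube, volume_real_coordBox b measurableSet_Ioc measurableSet_Ioo,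
    Real.volume_real_Ioc_of_le h, Real.volume_real_Ioo_of_le (by linarith)]
  ring

theorem volume_real_pathTube_inter_closedBall_le {r ρ : ℝ} (hr : 0 ≤ r) (hρ : 0 ≤ ρ) (s ℓ : ℝ)
    (y : Plane) :
    volume.real (pathTube b s ℓ ρ ∩ Metric.closedBall y r) ≤ 2 * r * (2 * ρ) := by
  have hsub : pathTube b s ℓ ρ ∩ Metric.closedBall y r ⊆
      coordBox b (Icc (b.repr y 0 - r) (b.repr y 0 + r)) (Ioo (-ρ) ρ) := by
    rintro z ⟨hz, hzy⟩
    have hcoord := abs_le.1 ((abs_coord_sub_le_dist b z y 0).trans hzy)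
    exact ⟨⟨by linarith, by linarith⟩, hz.2⟩
  refine (measureReal_mono hsub ?_).trans (le_of_eq ?_)
  · exact volume_coordBox_ne_top b measurableSet_Icc measurableSet_Ioo measure_Icc_lt_top.ne
      measure_Ioo_lt_top.ne
  · rw [volume_real_coordBox b measurableSet_Icc measurableSet_Ioo,
      Real.volume_real_Icc_of_le (by linarith), Real.volume_real_Ioo_of_le (by linarith)]
    ring

theorem pathTube_self (s ρ : ℝ) : pathTube b s s ρ = ∅ :=
  eq_empty_of_forall_notMem fun _ hy => hy.1.1.not_ge hy.1.2

theorem disjoint_pathTube {s ℓ s' ℓ' : ℝ} (h : ℓ ≤ s') (ρ : ℝ) :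
    Disjoint (pathTube b s ℓ ρ) (pathTube b s' ℓ' ρ) :=
  disjoint_left.2 fun _ hy hy' => (hy.1.2.trans h).not_gt hy'.1.1

theorem pathTube_union {s t ℓ : ℝ} (h : s ≤ t) (h' : t ≤ ℓ) (ρ : ℝ) :
    pathTube b s t ρ ∪ pathTube b t ℓ ρ = pathTube b s ℓ ρ := by
  rw [pathTube, pathTube, pathTube, ← Ioc_union_Ioc_eq_Ioc h h']
  exact ext fun y => or_and_right.symm

theorem isBounded_pathTube (s ℓ ρ : ℝ) : Bornology.IsBounded (pathTube b s ℓ ρ) := by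
  refine (Metric.isBounded_closedBall (x := (0 : Plane)) (r := max |s| |ℓ| + |ρ|)).subset
    fun y hy => ?_
  have h0 : |b.repr y 0| ≤ max |s| |ℓ| := abs_le_max_abs_abs hy.1.1.le hy.1.2
  have h1 : |b.repr y 1| ≤ |ρ| := (abs_lt.2 hy.2).le.trans (le_abs_self ρ)
  have hdist := dist_sq_eq_coord b y 0
  simp only [map_zero, PiLp.zero_apply, sub_zero] at hdist
  refine (sq_le_sq₀ dist_nonneg (by positivity)).1 ?_
  rw [hdist, ← sq_abs (b.repr y 0), ← sq_abs (b.repr y 1)]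
  nlinarith [abs_nonneg (b.repr y 0), abs_nonneg (b.repr y 1)]

end PathTube

section Sparse

variable {M : NetworkParams} {b : OrthonormalBasis (Fin 2) ℝ Plane} {x u : ℕ → Plane}

/-- The nodes are in general position with respect to the path up to the distance `ℓ`, on the scale
of `ρ`, and none of them is within `ρ₂` of the path. -/
structure IsSparse (b : OrthonormalBasis (Fin 2) ℝ Plane) (x : ℕ → Plane) (ρ ρ₂ ℓ : ℝ) :
    Prop where
  notMem_narrow : ∀ i, x i ∉ coordBox b (Icc (-ρ) (ℓ + 2 * ρ)) (Icc (-ρ₂) ρ₂)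
  notMem_start : ∀ i, x i ∉ coordBox b (Icc (-ρ) ρ) (Icc (-ρ) ρ)
  notMem_end : ∀ i, x i ∉ coordBox b (Icc (ℓ - 2 * ρ) (ℓ + 2 * ρ)) (Icc (-ρ) ρ)
  separated : ∀ i j, i ≠ j → x i ∈ pathTube b 0 ℓ ρ → 2 * ρ < dist (x i) (x j)
  coord_ne_zero : ∀ i, b.repr (x i) 1 ≠ 0
  coord_ne : ∀ i, |b.repr (x i) 1| ≠ ρ

theorem IsSparse.coord_mem_Ioo {ρ ρ₂ ℓ : ℝ} (hs : IsSparse b x ρ ρ₂ ℓ) {i : ℕ}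
    (hi : b.repr (x i) 0 ∈ Icc (-ρ) (ℓ + 2 * ρ)) (hi' : b.repr (x i) 1 ∈ Icc (-ρ) ρ) :
    b.repr (x i) 0 ∈ Ioo ρ (ℓ - 2 * ρ) := by
  refine ⟨not_le.1 fun h => ?_, not_le.1 fun h => ?_⟩
  · exact hs.notMem_start i ⟨⟨hi.1, h⟩, hi'⟩
  · exact hs.notMem_end i ⟨⟨h, hi.2⟩, hi'⟩

section Level

variable (hM : M.WeaklyAdmissible) (hb : b 0 = M.dir) (hx : IsLocallyFiniteConfig x)
  (hu : IsLocallyFiniteConfig u) {δ ℓ t : ℝ} (hδ : 0 < δ)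
  (hs : IsSparse b x (M.rateRadius δ) (M.rateRadius (2 * δ)) ℓ)
include hM hb hx hu hδ hs

/-- A node with at least one user would have to be within `rateRadius (2 * δ)` of the path. -/
theorem IsSparse.exists_of_le_lowerSharedRate (ht0 : 0 ≤ M.v * t)
    (htℓ : M.v * t ≤ ℓ + M.rateRadius δ) (h : δ ≤ M.lowerSharedRate x u t) :
    ∃ i, x i ∈ freeRegion (M.coverageRadius M.gam) u ∩ pathTube b 0 ℓ (M.rateRadius δ) ∧
      dist (M.position t) (x i) ≤ M.rateRadius δ := by
  obtain ⟨-, hdist⟩ :=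
    (le_lowerSharedRate_iff hM hx hδ rfl (position_ne hb (hs.coord_ne_zero _) t)).1 h
  set i := closestIndex x (M.position t)
  have hN : M.nodeUsers x u i = 0 := by
    by_contra hN
    have hN1 : (1 : ℝ) ≤ M.nodeUsers x u i := by exact_mod_cast Nat.one_le_iff_ne_zero.2 hN
    have hdist2 : dist (M.position t) (x i) ≤ M.rateRadius (2 * δ) :=
      hdist.trans (rateRadius_anti hM (by linarith) (by nlinarith))
    have hanti : M.rateRadius (2 * δ) ≤ M.rateRadius δ := rateRadius_anti hM hδ (by linarith)
    obtain ⟨h0, h1⟩ := mem_coordBox_of_dist_position_le hb hdist2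
    exact hs.notMem_narrow i ⟨⟨by linarith [h0.1], by linarith [h0.2]⟩, h1⟩
  rw [hN, Nat.cast_zero, zero_add, mul_one] at hdist
  obtain ⟨h0, h1⟩ := mem_coordBox_of_dist_position_le hb hdist
  have hloc := hs.coord_mem_Ioo ⟨by linarith [h0.1], by linarith [h0.2]⟩ h1
  have hρ := rateRadius_pos hM hδ
  exact ⟨i, ⟨(nodeUsers_eq_zero_iff hu i).1 hN,
    ⟨hρ.trans hloc.1, by linarith [hloc.2]⟩,
    abs_lt.1 ((abs_le.2 h1).lt_of_ne (hs.coord_ne i))⟩, hdist⟩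

theorem IsSparse.le_lowerSharedRate (hδr : M.rateRadius δ ≤ M.coverageRadius M.gam) {i : ℕ}
    (hi : x i ∈ freeRegion (M.coverageRadius M.gam) u ∩ pathTube b 0 ℓ (M.rateRadius δ))
    (hdist : dist (M.position t) (x i) ≤ M.rateRadius δ) : δ ≤ M.lowerSharedRate x u t := by
  have hclosest : closestIndex x (M.position t) = i := by
    by_contra hne
    linarith [hs.separated i _ (Ne.symm hne) hi.2, hx.mem_voronoiCell_closestIndex (M.position t) i,
      dist_triangle_left (x i) (x (closestIndex x (M.position t))) (M.position t)]
  rw [le_lowerSharedRate_iff hM hx hδ hclosest (position_ne hb (hs.coord_ne_zero i) t),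
    (nodeUsers_eq_zero_iff hu i).2 hi.1, Nat.cast_zero, zero_add, mul_one]
  exact ⟨hdist.trans hδr, hdist⟩

end Level

/-- Half the length of the chord cut out of the path by the disc of radius `ρ` around `y`; it is
positive if and only if the path meets the interior of the disc. -/
noncomputable def halfChord (b : OrthonormalBasis (Fin 2) ℝ Plane) (ρ : ℝ) (y : Plane) : ℝ :=
  √(ρ ^ 2 - b.repr y 1 ^ 2)

theorem halfChord_pos {ρ : ℝ} {y : Plane} (hy : b.repr y 1 ∈ Ioo (-ρ) ρ) :
    0 < halfChord b ρ y :=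
  Real.sqrt_pos.2 (sub_pos.2 (sq_lt_sq' hy.1 hy.2))

theorem halfChord_le {ρ : ℝ} (hρ : 0 ≤ ρ) (y : Plane) : halfChord b ρ y ≤ ρ :=
  Real.sqrt_le_iff.2 ⟨hρ, sub_le_self _ (sq_nonneg _)⟩

theorem dist_position_le_iff_mem_Icc (hM : M.WeaklyAdmissible) (hb : b 0 = M.dir) {ρ : ℝ}
    {y : Plane} (hy : b.repr y 1 ∈ Ioo (-ρ) ρ) (t : ℝ) :
    dist (M.position t) y ≤ ρ ↔
      t ∈ Icc ((b.repr y 0 - halfChord b ρ y) / M.v) ((b.repr y 0 + halfChord b ρ y) / M.v) := by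
  have hρ : 0 ≤ ρ := by linarith [hy.1, hy.2]
  have hsq : 0 ≤ ρ ^ 2 - b.repr y 1 ^ 2 := (sub_pos.2 (sq_lt_sq' hy.1 hy.2)).le
  have hchord : |M.v * t - b.repr y 0| ≤ halfChord b ρ y ↔ dist (M.position t) y ≤ ρ := by
    rw [← sq_le_sq₀ dist_nonneg hρ, dist_position_sq hb, ← le_sub_iff_add_le, halfChord,
      Real.le_sqrt (abs_nonneg _) hsq, sq_abs]
  rw [← hchord, abs_sub_le_iff, mem_Icc, div_le_iff₀' hM.v_pos, le_div_iff₀' hM.v_pos]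
  constructor <;> rintro ⟨h₁, h₂⟩ <;> constructor <;> linarith

theorem encard_upCrossingSet_inter_Iic (hM : M.WeaklyAdmissible) (hb : b 0 = M.dir)
    (hx : IsLocallyFiniteConfig x) (hu : IsLocallyFiniteConfig u) {δ ℓ : ℝ} (hδ : 0 < δ)
    (hδr : M.rateRadius δ ≤ M.coverageRadius M.gam)
    (hs : IsSparse b x (M.rateRadius δ) (M.rateRadius (2 * δ)) ℓ) :
    (upCrossingSet (M.lowerSharedRate x u) δ ∩ Iic (ℓ / M.v)).encard =
      freeCount (M.coverageRadius M.gam) x u (pathTube b 0 ℓ (M.rateRadius δ)) := by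
  have hρ := rateRadius_pos hM hδ
  have hv := hM.v_pos
  set ρ := M.rateRadius δ
  set G : Set ℕ := {i | x i ∈ freeRegion (M.coverageRadius M.gam) u ∩ pathTube b 0 ℓ ρ}
  have hGfin : G.Finite := by
    obtain ⟨R, hR⟩ := (isBounded_pathTube b 0 ℓ ρ).subset_closedBall 0
    exact (hx 0 R).subset fun i hi => hR hi.2
  have hloc : ∀ i ∈ G, b.repr (x i) 0 ∈ Ioo ρ (ℓ - 2 * ρ) := fun i hi =>
    hs.coord_mem_Ioo ⟨by linarith [hi.2.1.1], by linarith [hi.2.1.2]⟩ (Ioo_subset_Icc_self hi.2.2)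
  have hchord (i : ℕ) (hi : i ∈ G) := dist_position_le_iff_mem_Icc hM hb hi.2.2
  refine encard_upCrossingSet_inter_Iic_eq hGfin (T' := (ℓ + ρ) / M.v)
    (α := fun i => (b.repr (x i) 0 - halfChord b ρ (x i)) / M.v)
    (β := fun i => (b.repr (x i) 0 + halfChord b ρ (x i)) / M.v) (by gcongr; linarith)
    (fun t ht => ?_) (fun i hi => ⟨div_pos ?_ hv, ?_⟩) (fun i hi => ?_) fun i hi j hj hij => ?_
  · have htv : M.v * t ≤ ℓ + ρ := ((lt_div_iff₀' hv).1 ht.2).le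
    have hexists : δ ≤ M.lowerSharedRate x u t ↔ ∃ i ∈ G, dist (M.position t) (x i) ≤ ρ :=
      ⟨hs.exists_of_le_lowerSharedRate hM hb hx hu hδ (mul_pos hv ht.1).le htv,
        fun ⟨_, hi, hdist⟩ => hs.le_lowerSharedRate hM hb hx hu hδ hδr hi hdist⟩
    rw [hexists]
    exact exists_congr fun i => and_congr_right fun hi => hchord i hi t
  · linarith [(hloc i hi).1, halfChord_le (b := b) hρ.le (x i)]
  · gcongr
    linarith [(hloc i hi).2, halfChord_pos hi.2.2]
  · gcongr
    linarith [halfChord_pos hi.2.2]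
  · refine disjoint_left.2 fun t hti htj => ?_
    linarith [hs.separated i j hij hi.2, (hchord i hi t).2 hti, (hchord j hj t).2 htj,
      dist_triangle_left (x i) (x j) (M.position t)]

end Sparse

end NetworkParams

namespace IsPoissonPointProcess

open NetworkParams

variable {Ω : Type*} [MeasurableSpace Ω] {P : Measure Ω} [IsProbabilityMeasure P]
  {X U : ℕ → Ω → Plane} {lam xi r : ℝ} {b : OrthonormalBasis (Fin 2) ℝ Plane}

section FreeNodes

variable (hU : IsPoissonPointProcess P U xi) (hr : 0 ≤ r)
include hU hr

theorem integral_abs_volume_freeRegion_pathTube_sub_le (hl : 0 ≤ lam)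
    (b : OrthonormalBasis (Fin 2) ℝ Plane) {s ℓ ρ : ℝ} (h : s ≤ ℓ) (hρ : 0 ≤ ρ) :
    ∫ ω, |lam * volume.real (freeRegion r (fun j => U j ω) ∩ pathTube b s ℓ ρ) -
        lam * Real.exp (-(xi * Real.pi * r ^ 2)) * ((ℓ - s) * (2 * ρ))| ∂P ≤
      lam * √(8 * r * ρ * ((ℓ - s) * (2 * ρ))) := by
  have hvol := hU.integral_abs_volume_freeRegion_sub_le hr (volume_pathTube_ne_top b s ℓ ρ)
    (volume_real_pathTube_inter_closedBall_le b (by positivity) hρ s ℓ)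
  rw [volume_real_pathTube b h hρ] at hvol
  simp only [mul_assoc lam, ← mul_sub, abs_mul, abs_of_nonneg hl, integral_const_mul]
  refine mul_le_mul_of_nonneg_left (hvol.trans_eq ?_) hl
  ring_nf

variable (hX : IsPoissonPointProcess P X lam)
  (hXU : IndepFun (fun ω i => X i ω) (fun ω j => U j ω) P)
include hX hXU

theorem real_freeCount_pathTube_eq_zero_le (b : OrthonormalBasis (Fin 2) ℝ Plane) {s ℓ ρ : ℝ}
    (h : s ≤ ℓ) (hρ : 0 ≤ ρ) :
    P.real {ω | freeCount r (fun i => X i ω) (fun j => U j ω) (pathTube b s ℓ ρ) = 0} ≤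
      Real.exp (-(lam * Real.exp (-(xi * Real.pi * r ^ 2)) * ((ℓ - s) * (2 * ρ)))) +
        lam * √(8 * r * ρ * ((ℓ - s) * (2 * ρ))) := by
  have := hX.intensity_pos
  have : 0 ≤ ℓ - s := sub_nonneg.2 h
  have hmean : 0 ≤ lam * Real.exp (-(xi * Real.pi * r ^ 2)) * ((ℓ - s) * (2 * ρ)) := by positivity
  refine (hX.real_freeCount_eq_zero_le hU.measurable_point hXU r
    (measurableSet_pathTube b s ℓ ρ) (volume_pathTube_ne_top b s ℓ ρ) hmean).trans ?_
  exact add_le_add_right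
    (hU.integral_abs_volume_freeRegion_pathTube_sub_le hr hX.intensity_pos.le b h hρ) _

theorem ae_exists_mem_freeRegion (b : OrthonormalBasis (Fin 2) ℝ Plane) {ε : ℝ} (hε : 0 < ε)
    (T : ℝ) :
    ∀ᵐ ω ∂P, ∃ i, X i ω ∈ freeRegion r (fun j => U j ω) ∧
      T < b.repr (X i ω) 0 ∧ |b.repr (X i ω) 1| < ε := by
  set c := lam * Real.exp (-(xi * Real.pi * r ^ 2))
  have hc : 0 < c := mul_pos hX.intensity_pos (Real.exp_pos _)
  -- The tubes of radius `1 / τ ^ 2` and length `τ ^ 3` have large areas `2 * τ`, but are so thin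
  -- that their free areas hardly fluctuate.
  have hbound : ∀ᶠ τ : ℝ in atTop, P.real {ω | ¬ ∃ i, X i ω ∈ freeRegion r (fun j => U j ω) ∧
      T < b.repr (X i ω) 0 ∧ |b.repr (X i ω) 1| < ε} ≤
        Real.exp (-(c * 2 * τ)) + lam * √(16 * r * τ⁻¹) := by
    have hthin : Tendsto (fun τ : ℝ => (τ ^ 2)⁻¹) atTop (𝓝 0) :=
      tendsto_inv_atTop_zero.comp (tendsto_pow_atTop two_ne_zero)
    filter_upwards [eventually_gt_atTop 0, hthin.eventually_lt_const hε] with τ hτ hτε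
    have htube := real_freeCount_pathTube_eq_zero_le hU hr hX hXU b
      (le_add_of_nonneg_right (pow_nonneg hτ.le 3) : T ≤ T + τ ^ 3)
      (inv_nonneg.2 (sq_nonneg τ))
    have harea : (T + τ ^ 3 - T) * (2 * (τ ^ 2)⁻¹) = 2 * τ := by field_simp; ring
    have hfluct : 8 * r * (τ ^ 2)⁻¹ * (2 * τ) = 16 * r * τ⁻¹ := by field_simp; ring
    rw [harea, hfluct, ← mul_assoc] at htube
    refine (measureReal_mono fun ω hω => ?_).trans htube
    exact (pointCount_eq_zero_iff _ _).2 fun i hi =>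
      hω ⟨i, hi.1, hi.2.1.1, (abs_lt.2 hi.2.2).trans hτε⟩
  have hlim : Tendsto (fun τ : ℝ => Real.exp (-(c * 2 * τ)) + lam * √(16 * r * τ⁻¹)) atTop
      (𝓝 0) := by
    have hexp : Tendsto (fun τ : ℝ => Real.exp (-(c * 2 * τ))) atTop (𝓝 0) :=
      Real.tendsto_exp_neg_atTop_nhds_zero.comp (tendsto_id.const_mul_atTop (by positivity))
    simpa using hexp.add (((tendsto_inv_atTop_zero.const_mul (16 * r)).sqrt).const_mul lam)
  exact (measureReal_eq_zero_iff).1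
    (le_antisymm (ge_of_tendsto hlim hbound) measureReal_nonneg)

theorem ae_forall_exists_mem_freeRegion (b : OrthonormalBasis (Fin 2) ℝ Plane) {ε : ℝ}
    (hε : 0 < ε) :
    ∀ᵐ ω ∂P, ∀ T : ℝ, ∃ i, X i ω ∈ freeRegion r (fun j => U j ω) ∧
      T < b.repr (X i ω) 0 ∧ |b.repr (X i ω) 1| < ε := by
  filter_upwards [ae_all_iff.2 fun m : ℕ => ae_exists_mem_freeRegion hU hr hX hXU b hε m]
    with ω hω T
  obtain ⟨m, hm⟩ := exists_nat_ge T
  obtain ⟨i, hfree, hfar, hclose⟩ := hω m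
  exact ⟨i, hfree, hm.trans_lt hfar, hclose⟩

end FreeNodes

theorem ae_coord_ne (hX : IsPoissonPointProcess P X lam)
    (b : OrthonormalBasis (Fin 2) ℝ Plane) (d : ℝ) : ∀ᵐ ω ∂P, ∀ i, b.repr (X i ω) 1 ≠ d := by
  have hline : volume (coordBox b univ {d}) = 0 := by
    rw [volume_coordBox b .univ (measurableSet_singleton d), Real.volume_singleton, mul_zero]
  filter_upwards [hX.ae_forall_notMem
    (measurableSet_coordBox b .univ (measurableSet_singleton d)) hline]
    with ω hω i hi using hω i ⟨mem_univ _, hi⟩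

section UpCrossings

variable {M : NetworkParams} (hM : M.WeaklyAdmissible) {δ : ℝ} (hδ : 0 < δ)
include hM hδ

theorem ae_frequently_lowerSharedRate_lt (hX : IsPoissonPointProcess P X lam)
    (U : ℕ → Ω → Plane) :
    ∀ᵐ ω ∂P, ∃ᶠ t in atTop, ∀ᶠ s in 𝓝 t,
      M.lowerSharedRate (fun i => X i ω) (fun j => U j ω) s < δ := by
  have hr := coverageRadius_pos hM hM.gam_pos
  have hv := hM.v_pos
  set R := M.coverageRadius M.gam + 1
  have : 0 < R := by positivity
  set step := (2 * R + 1) / M.v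
  have hstep : 0 < step := by positivity
  have hdisj : Pairwise fun k l : ℕ => Disjoint (Metric.closedBall (M.position (k * step)) R)
      (Metric.closedBall (M.position (l * step)) R) := by
    intro k l hkl
    have hkl1 : (1 : ℝ) ≤ |(k : ℝ) - l| := by
      have : (1 : ℤ) ≤ |(k : ℤ) - l| := Int.one_le_abs (sub_ne_zero.2 (by exact_mod_cast hkl))
      exact_mod_cast this
    have hdist : dist (M.position (k * step)) (M.position (l * step)) =
        |(k : ℝ) - l| * (2 * R + 1) := by
      rw [dist_position_position hM, ← sub_mul, abs_mul, abs_of_pos hstep, mul_left_comm,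
        mul_div_cancel₀ _ hv.ne']
    refine Metric.closedBall_disjoint_closedBall ?_
    rw [hdist]
    nlinarith
  filter_upwards [hX.ae_frequently_forall_notMem (fun k => measurableSet_closedBall)
    (by finiteness) (fun k => EuclideanSpace.volume_closedBall_fin_two _ _) hdisj] with ω hω
  have hatTop : Tendsto (fun k : ℕ => (k : ℝ) * step) atTop atTop :=
    tendsto_natCast_atTop_atTop.atTop_mul_const hstep
  exact hatTop.frequently (hω.mono fun k hk => eventually_lowerSharedRate_lt hδ (by simp [R]) hk)

variable (hX : IsPoissonPointProcess P X lam) (hU : IsPoissonPointProcess P U xi)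
  (hXU : IndepFun (fun ω i => X i ω) (fun ω j => U j ω) P)
include hX hU hXU

theorem ae_frequently_le_lowerSharedRate :
    ∀ᵐ ω ∂P, ∃ᶠ t in atTop, ∀ᶠ s in 𝓝 t,
      δ ≤ M.lowerSharedRate (fun i => X i ω) (fun j => U j ω) s := by
  obtain ⟨b, hb⟩ := exists_orthonormalBasis_zero_eq hM.norm_dir
  have hr := coverageRadius_pos hM hM.gam_pos
  have hv := hM.v_pos
  set r := M.coverageRadius M.gam
  set ε := min r (M.rateRadius δ) / 2 with hε
  have hε0 : 0 < ε := half_pos (lt_min hr (rateRadius_pos hM hδ))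
  have hεr : 2 * ε ≤ r := by linarith [min_le_left r (M.rateRadius δ)]
  have hερ : 2 * ε ≤ M.rateRadius δ := by linarith [min_le_right r (M.rateRadius δ)]
  filter_upwards [hX.ae_finite_closedBall, hU.ae_finite_closedBall, hX.ae_coord_ne b 0,
    ae_forall_exists_mem_freeRegion (r := r + 4 * ε) hU (by positivity) hX hXU b hε0]
    with ω hx hu hline hfree
  refine frequently_atTop.2 fun T => ?_
  obtain ⟨i, hi, hfar, hclose⟩ := hfree (M.v * T)
  refine ⟨b.repr (X i ω) 0 / M.v, ((lt_div_iff₀' hv).2 hfar).le,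
    eventually_le_lowerSharedRate hM hx hu (fun i => position_ne hb (hline i)) hδ hεr hερ hi ?_⟩
  have hdist : dist (M.position (b.repr (X i ω) 0 / M.v)) (X i ω) = |b.repr (X i ω) 1| := by
    rw [← sq_eq_sq₀ dist_nonneg (abs_nonneg _), dist_position_sq hb, mul_div_cancel₀ _ hv.ne',
      sub_self, sq_abs, zero_pow two_ne_zero, zero_add]
  linarith

theorem ae_upCrossingSet :
    ∀ᵐ ω ∂P,
      (upCrossingSet (M.lowerSharedRate (fun i => X i ω) (fun j => U j ω)) δ).Infinite ∧
      ∀ t : ℝ,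
        (upCrossingSet (M.lowerSharedRate (fun i => X i ω) (fun j => U j ω)) δ ∩
          Iic t).Finite := by
  obtain ⟨b, hb⟩ := exists_orthonormalBasis_zero_eq hM.norm_dir
  filter_upwards [hX.ae_finite_closedBall, hX.ae_coord_ne b 0,
    ae_frequently_lowerSharedRate_lt hM hδ hX U, ae_frequently_le_lowerSharedRate hM hδ hX hU hXU]
    with ω hx hline hlow hhigh
  have hlevel := hasLocallyFiniteLevelSet_lowerSharedRate (u := fun j => U j ω) hM hx
    (fun i => position_ne hb (hline i)) hδ
  exact ⟨hlevel.infinite_upCrossingSet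
    (hlow.mono fun t ht => ht.filter_mono nhdsWithin_le_nhds)
    (hhigh.mono fun t ht => ht.filter_mono nhdsWithin_le_nhds),
    hlevel.finite_upCrossingSet_inter_Iic⟩

end UpCrossings

section Sparse

variable (hX : IsPoissonPointProcess P X lam) (b : OrthonormalBasis (Fin 2) ℝ Plane)
include hX

theorem real_exists_mem_coordBox_le {c d e : ℝ} (hcd : c ≤ d) (he : 0 ≤ e) :
    P.real {ω | ∃ i, X i ω ∈ coordBox b (Icc c d) (Icc (-e) e)} ≤ lam * ((d - c) * (2 * e)) := by
  simp_rw [← one_le_pointCount_iff]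
  rw [← volume_real_coordBox_Icc b hcd he]
  exact hX.real_one_le_count_le (measurableSet_coordBox b measurableSet_Icc measurableSet_Icc)
    (volume_coordBox_ne_top b measurableSet_Icc measurableSet_Icc measure_Icc_lt_top.ne
      measure_Icc_lt_top.ne)

theorem real_two_le_count_coordBox_le {c d e : ℝ} (hcd : c ≤ d) (he : 0 ≤ e) :
    P.real {ω | 2 ≤ pointCount (fun i => X i ω) (coordBox b (Icc c d) (Icc (-e) e))} ≤
      (lam * ((d - c) * (2 * e))) ^ 2 := by
  rw [← volume_real_coordBox_Icc b hcd he]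
  exact hX.real_two_le_count_le (measurableSet_coordBox b measurableSet_Icc measurableSet_Icc)
    (volume_coordBox_ne_top b measurableSet_Icc measurableSet_Icc measure_Icc_lt_top.ne
      measure_Icc_lt_top.ne)

/-- Two nodes at distance at most `2 * ρ`, the first of them in the tube, share one of the boxes of
length `5 * ρ` and width `6 * ρ` around the segments of length `ρ` of the path. -/
theorem real_exists_dist_le_le {ρ ℓ : ℝ} (hρ : 0 < ρ) (hℓ : 0 ≤ ℓ) :
    P.real {ω | ∃ i j, i ≠ j ∧ X i ω ∈ pathTube b 0 ℓ ρ ∧ dist (X i ω) (X j ω) ≤ 2 * ρ} ≤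
      (ℓ / ρ + 1) * (lam * (5 * ρ * (6 * ρ))) ^ 2 := by
  set box : ℕ → Set Plane := fun k =>
    coordBox b (Icc ((k - 2 : ℝ) * ρ) ((k + 3 : ℝ) * ρ)) (Icc (-(3 * ρ)) (3 * ρ))
  have hbox (k : ℕ) : P.real {ω | 2 ≤ pointCount (fun i => X i ω) (box k)} ≤
      (lam * (5 * ρ * (6 * ρ))) ^ 2 :=
    (hX.real_two_le_count_coordBox_le b (by nlinarith) (by positivity)).trans_eq (by ring)
  have hcover : {ω | ∃ i j, i ≠ j ∧ X i ω ∈ pathTube b 0 ℓ ρ ∧ dist (X i ω) (X j ω) ≤ 2 * ρ} ⊆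
      ⋃ k ∈ Finset.range (⌊ℓ / ρ⌋₊ + 1), {ω | 2 ≤ pointCount (fun i => X i ω) (box k)} := by
    rintro ω ⟨i, j, hij, ⟨hi0, hi1⟩, hdist⟩
    have hfloor := Nat.floor_le (div_nonneg hi0.1.le hρ.le)
    have hlt := Nat.lt_floor_add_one (b.repr (X i ω) 0 / ρ)
    rw [le_div_iff₀ hρ] at hfloor
    rw [div_lt_iff₀ hρ] at hlt
    have hd0 := abs_le.1 ((abs_coord_sub_le_dist b (X i ω) (X j ω) 0).trans hdist)
    have hd1 := abs_le.1 ((abs_coord_sub_le_dist b (X i ω) (X j ω) 1).trans hdist)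
    refine mem_biUnion (x := ⌊b.repr (X i ω) 0 / ρ⌋₊) ?_ (two_le_pointCount hij
      ⟨⟨by linarith, by linarith⟩, by linarith [hi1.1], by linarith [hi1.2]⟩
      ⟨⟨by linarith, by linarith⟩, by linarith [hi1.1], by linarith [hi1.2]⟩)
    rw [Finset.mem_coe, Finset.mem_range, Nat.lt_succ_iff]
    gcongr
    exact hi0.2
  calc _ ≤ ∑ k ∈ Finset.range (⌊ℓ / ρ⌋₊ + 1),
        P.real {ω | 2 ≤ pointCount (fun i => X i ω) (box k)} :=
        (measureReal_mono hcover (measure_ne_top _ _)).trans (measureReal_biUnion_finset_le _ _)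
    _ ≤ (⌊ℓ / ρ⌋₊ + 1 : ℕ) * (lam * (5 * ρ * (6 * ρ))) ^ 2 := by
        simpa using Finset.sum_le_sum fun k (_ : k ∈ Finset.range (⌊ℓ / ρ⌋₊ + 1)) => hbox k
    _ ≤ _ := by
        push_cast
        gcongr
        exact Nat.floor_le (by positivity)

theorem real_not_isSparse_le {ρ ρ₂ ℓ : ℝ} (hρ : 0 < ρ) (hρ₂ : 0 ≤ ρ₂) (hℓ : 0 ≤ ℓ) :
    P.real {ω | ¬ IsSparse b (fun i => X i ω) ρ ρ₂ ℓ} ≤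
      lam * ((ℓ + 3 * ρ) * (2 * ρ₂)) + lam * (2 * ρ * (2 * ρ)) + lam * (4 * ρ * (2 * ρ)) +
        (ℓ / ρ + 1) * (lam * (5 * ρ * (6 * ρ))) ^ 2 := by
  set narrow := {ω | ∃ i, X i ω ∈ coordBox b (Icc (-ρ) (ℓ + 2 * ρ)) (Icc (-ρ₂) ρ₂)}
  set start := {ω | ∃ i, X i ω ∈ coordBox b (Icc (-ρ) ρ) (Icc (-ρ) ρ)}
  set finish := {ω | ∃ i, X i ω ∈ coordBox b (Icc (ℓ - 2 * ρ) (ℓ + 2 * ρ)) (Icc (-ρ) ρ)}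
  set close := {ω | ∃ i j, i ≠ j ∧ X i ω ∈ pathTube b 0 ℓ ρ ∧ dist (X i ω) (X j ω) ≤ 2 * ρ}
  have hnarrow : P.real narrow ≤ lam * ((ℓ + 3 * ρ) * (2 * ρ₂)) :=
    (hX.real_exists_mem_coordBox_le b (by linarith) hρ₂).trans_eq (by ring)
  have hstart : P.real start ≤ lam * (2 * ρ * (2 * ρ)) :=
    (hX.real_exists_mem_coordBox_le b (by linarith) hρ.le).trans_eq (by ring)
  have hfinish : P.real finish ≤ lam * (4 * ρ * (2 * ρ)) :=
    (hX.real_exists_mem_coordBox_le b (by linarith) hρ.le).trans_eq (by ring)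
  have hclose : P.real close ≤ _ := hX.real_exists_dist_le_le b hρ hℓ
  have hsub : {ω | ¬ IsSparse b (fun i => X i ω) ρ ρ₂ ℓ} ≤ᵐ[P]
      (narrow ∪ start ∪ finish ∪ close : Set Ω) := by
    filter_upwards [hX.ae_coord_ne b 0, hX.ae_coord_ne b ρ, hX.ae_coord_ne b (-ρ)]
      with ω h0 hpos hneg hω
    refine not_not.1 fun hcon : ω ∉ narrow ∪ start ∪ finish ∪ close => ?_
    simp only [mem_union, not_or] at hcon
    obtain ⟨⟨⟨hn, hs⟩, hf⟩, hc⟩ := hcon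
    exact hω ⟨not_exists.1 hn, not_exists.1 hs, not_exists.1 hf,
      fun i j hij hi => not_le.1 fun hle => hc ⟨i, j, hij, hi, hle⟩, h0,
      fun i hi => ((abs_eq hρ.le).1 hi).elim (hpos i) (hneg i)⟩
  calc _ ≤ P.real (narrow ∪ start ∪ finish ∪ close) :=
        ENNReal.toReal_mono (measure_ne_top _ _) (measure_mono_ae hsub)
    _ ≤ P.real narrow + P.real start + P.real finish + P.real close := by
        refine (measureReal_union_le _ _).trans (add_le_add_left ?_ _)
        exact (measureReal_union_le _ _).trans (add_le_add_left (measureReal_union_le _ _) _)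
    _ ≤ _ := by gcongr

theorem tendsto_real_not_isSparse {ι : Type*} {l : Filter ι} {ρ ρ₂ : ι → ℝ} {A : ℝ}
    (hA : 0 ≤ A) (hρ : Tendsto ρ l (𝓝[>] 0)) (hρ₂ : ∀ᶠ d in l, 0 ≤ ρ₂ d)
    (hratio : Tendsto (fun d => ρ₂ d / ρ d) l (𝓝 0)) :
    Tendsto (fun d => P.real {ω | ¬ IsSparse b (fun i => X i ω) (ρ d) (ρ₂ d) (A / ρ d)}) l
      (𝓝 0) := by
  rw [tendsto_nhdsWithin_iff] at hρ
  let bound (z : ℝ × ℝ) : ℝ := lam * ((A + 3 * z.1 ^ 2) * (2 * z.2)) + 12 * lam * z.1 ^ 2 +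
    900 * lam ^ 2 * (A * z.1 ^ 2 + z.1 ^ 4)
  have hcont : Continuous bound := by fun_prop
  have hbound : Tendsto (fun d => bound (ρ d, ρ₂ d / ρ d)) l (𝓝 0) := by
    have hzero : bound (0, 0) = 0 := by simp [bound]
    rw [← hzero]
    exact (hcont.tendsto (0, 0)).comp (hρ.1.prodMk_nhds hratio)
  refine squeeze_zero' (Eventually.of_forall fun _ => measureReal_nonneg) ?_ hbound
  filter_upwards [hρ.2, hρ₂] with d hd hd₂
  have hd : 0 < ρ d := hd
  refine (hX.real_not_isSparse_le b hd hd₂ (div_nonneg hA hd.le)).trans_eq ?_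
  simp only [bound]
  field

end Sparse

end IsPoissonPointProcess

/-- `H s t` is the number of points in `(s, t]` of a random configuration of points on the line. -/
structure IsIntervalCount {Ω : Type*} [MeasurableSpace Ω] (H : ℝ → ℝ → Ω → ℕ∞) : Prop where
  measurable : ∀ s t, Measurable (H s t)
  self : ∀ s ω, H s s ω = 0
  add : ∀ ⦃s t u⦄, s ≤ t → t ≤ u → ∀ ω, H s t ω + H t u ω = H s u ω

section Gap

variable {Ω : Type*}

/-- The `n`-th point after time `0` lies in `(s, t]` and there is no point in `(t, u]`. -/
def gapEvent (H : ℝ → ℝ → Ω → ℕ∞) (n : ℕ) (s t u : ℝ) : Set Ω :=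
  {ω | H 0 s ω < n ∧ n ≤ H 0 t ω ∧ H t u ω = 0}

/-- The `n`-th point lies in one of the first `K` cells of mesh `η` and there is no point within
time `y` after this cell. -/
def gridGapEvent (H : ℝ → ℝ → Ω → ℕ∞) (n : ℕ) (η y : ℝ) (K : ℕ) : Set Ω :=
  ⋃ k ∈ Finset.range K, gapEvent H n (k * η) ((k + 1 : ℕ) * η) ((k + 1 : ℕ) * η + y)

/-- The event that at time `t` the arrival times `T 1, T 2, …` do not match the counts `H`. -/
def timeMismatch (T : ℕ → Ω → ℝ) (H : ℝ → ℝ → Ω → ℕ∞) (t : ℝ) : Set Ω :=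
  {ω | ¬ ∀ n : ℕ, T n ω ≤ t ↔ n ≤ H 0 t ω}

/-- The arrival times and the counts do not match at one of the times that occur in
`gridGapEvent`. -/
def gridMismatch (T : ℕ → Ω → ℝ) (H : ℝ → ℝ → Ω → ℕ∞) (η y : ℝ) (K : ℕ) : Set Ω :=
  ⋃ k ∈ Finset.range (K + 1), timeMismatch T H (k * η) ∪ timeMismatch T H (k * η + y)

theorem gapEvent_eq (H : ℝ → ℝ → Ω → ℕ∞) (n : ℕ) (s t u : ℝ) :
    gapEvent H n s t u =
      {ω | H 0 s ω < n ∧ H t u ω = 0} \ {ω | H 0 t ω < n ∧ H t u ω = 0} := by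
  ext ω
  simp only [gapEvent, mem_ofPred_eq, Set.mem_sdiff, ← not_lt]
  tauto

theorem le_iff_of_notMem_gridMismatch {T : ℕ → Ω → ℝ} {H : ℝ → ℝ → Ω → ℕ∞} {η y : ℝ} {K k : ℕ}
    {ω : Ω} (hω : ω ∉ gridMismatch T H η y K) (hk : k ≤ K) (n : ℕ) :
    (T n ω ≤ k * η ↔ n ≤ H 0 (k * η) ω) ∧ (T n ω ≤ k * η + y ↔ n ≤ H 0 (k * η + y) ω) := by
  have hk' : ω ∉ timeMismatch T H (k * η) ∪ timeMismatch T H (k * η + y) := fun h =>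
    hω (mem_biUnion (Finset.mem_coe.2 (Finset.mem_range_succ_iff.2 hk)) h)
  rw [mem_union, not_or] at hk'
  exact ⟨not_not.1 hk'.1 n, not_not.1 hk'.2 n⟩

theorem real_gridMismatch_le [MeasurableSpace Ω] (P : Measure Ω) (T : ℕ → Ω → ℝ)
    (H : ℝ → ℝ → Ω → ℕ∞) (η y : ℝ) (K : ℕ) :
    P.real (gridMismatch T H η y K) ≤ ∑ k ∈ Finset.range (K + 1),
      (P.real (timeMismatch T H (k * η)) + P.real (timeMismatch T H (k * η + y))) :=
  (measureReal_biUnion_finset_le _ _).trans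
    (Finset.sum_le_sum fun _ _ => measureReal_union_le _ _)

end Gap

theorem natCast_mul_le_natCast_succ_mul {η : ℝ} (hη : 0 ≤ η) (k : ℕ) :
    (k : ℝ) * η ≤ (k + 1 : ℕ) * η := by
  gcongr
  exact k.le_succ

namespace IsIntervalCount

variable {Ω : Type*} [MeasurableSpace Ω] {H : ℝ → ℝ → Ω → ℕ∞} {n : ℕ} {s t u : ℝ} {ω : Ω}

theorem mono (hH : IsIntervalCount H) (hst : s ≤ t) (htu : t ≤ u) (ω : Ω) :
    H s t ω ≤ H s u ω := by
  rw [← hH.add hst htu ω]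
  exact le_self_add

theorem measurableSet_lt (hH : IsIntervalCount H) (n : ℕ) (s t : ℝ) :
    MeasurableSet {ω | H s t ω < n} :=
  hH.measurable s t (MeasurableSet.of_discrete (s := Iio (n : ℕ∞)))

theorem measurableSet_eq_zero (hH : IsIntervalCount H) (s t : ℝ) :
    MeasurableSet {ω | H s t ω = 0} :=
  hH.measurable s t (measurableSet_singleton 0)

theorem measurableSet_gapEvent (hH : IsIntervalCount H) (n : ℕ) (s t u : ℝ) :
    MeasurableSet (gapEvent H n s t u) := by
  rw [gapEvent_eq]
  exact ((hH.measurableSet_lt n 0 s).inter (hH.measurableSet_eq_zero t u)).diff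
    ((hH.measurableSet_lt n 0 t).inter (hH.measurableSet_eq_zero t u))

theorem disjoint_gapEvent (hH : IsIntervalCount H) {s' t' u' : ℝ} (ht : 0 ≤ t) (h : t ≤ s') :
    Disjoint (gapEvent H n s t u) (gapEvent H n s' t' u') :=
  disjoint_left.2 fun ω hω hω' => ((hω.2.1.trans (hH.mono ht h ω)).trans_lt hω'.1).false

theorem real_gapEvent (hH : IsIntervalCount H) (P : Measure Ω) [IsFiniteMeasure P] (n : ℕ)
    (hs : 0 ≤ s) (hst : s ≤ t) (u : ℝ) :
    P.real (gapEvent H n s t u) = P.real {ω | H 0 s ω < n ∧ H t u ω = 0} -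
      P.real {ω | H 0 t ω < n ∧ H t u ω = 0} := by
  rw [gapEvent_eq]
  exact measureReal_sdiff (fun ω hω => ⟨(hH.mono hs hst ω).trans_lt hω.1, hω.2⟩)
    ((hH.measurableSet_lt n 0 t).inter (hH.measurableSet_eq_zero t u))

theorem lt_sub_of_mem_gapEvent (hH : IsIntervalCount H) {τ : ℕ → ℝ} (hs : 0 ≤ s) (hst : s ≤ t)
    (htu : t ≤ u) (hω : ω ∈ gapEvent H n s t u) (hone : H s t ω < 2)
    (hn : τ n ≤ t ↔ n ≤ H 0 t ω) (hsucc : τ (n + 1) ≤ u ↔ (n + 1 : ℕ) ≤ H 0 u ω) :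
    u - t < τ (n + 1) - τ n := by
  obtain ⟨hlt, hle, hvoid⟩ := hω
  have hu : H 0 u ω < (n + 1 : ℕ) := by
    rw [← hH.add (hs.trans hst) htu ω, hvoid, add_zero, ← hH.add hs hst ω, Nat.cast_succ]
    have hle_one : H s t ω ≤ 1 := Order.le_of_lt_add_one (hone.trans_eq one_add_one_eq_two.symm)
    exact ENat.add_lt_add_of_lt_of_le (hle_one.trans_lt (by simp)).ne hlt hle_one
  linarith [hn.2 hle, not_le.1 fun h => (hsucc.1 h).not_gt hu]

theorem sub_lt_of_ne_zero (hH : IsIntervalCount H) {τ : ℕ → ℝ} (ht : 0 ≤ t) (htu : t ≤ u)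
    (hlt : H 0 s ω < n) (hle : n ≤ H 0 t ω) (hne : H t u ω ≠ 0) (hn : τ n ≤ s ↔ n ≤ H 0 s ω)
    (hsucc : τ (n + 1) ≤ u ↔ (n + 1 : ℕ) ≤ H 0 u ω) : τ (n + 1) - τ n < u - s := by
  have hu : ((n + 1 : ℕ) : ℕ∞) ≤ H 0 u ω := by
    rw [← hH.add ht htu ω, Nat.cast_succ]
    exact add_le_add hle (Order.one_le_iff_ne_zero.2 hne)
  linarith [hsucc.2 hu, not_le.1 fun h => (hn.1 h).not_gt hlt]

theorem natCast_le_of_forall_ne_zero (hH : IsIntervalCount H) {τ : ℝ} (hτ : 0 ≤ τ) (n : ℕ)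
    (h : ∀ k < n, H (k * τ) ((k + 1 : ℕ) * τ) ω ≠ 0) : (n : ℕ∞) ≤ H 0 (n * τ) ω := by
  induction n with
  | zero => exact zero_le
  | succ n ih =>
    rw [← hH.add (by positivity) (natCast_mul_le_natCast_succ_mul hτ n) ω, Nat.cast_succ]
    exact add_le_add (ih fun k hk => h k (hk.trans n.lt_succ_self))
      (Order.one_le_iff_ne_zero.2 (h n n.lt_succ_self))

theorem exists_cell (hH : IsIntervalCount H) {η : ℝ} (hη : 0 ≤ η) (hn : 1 ≤ n) {K : ℕ}
    (hK : n ≤ H 0 (K * η) ω) :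
    ∃ k < K, H 0 (k * η) ω < n ∧ n ≤ H 0 ((k + 1 : ℕ) * η) ω := by
  obtain ⟨k, hk, hk'⟩ := Nat.exists_not_and_succ_of_not_zero_of_exists
    (p := fun k : ℕ => n ≤ H 0 (k * η) ω)
    (by simpa [hH.self] using Nat.one_le_iff_ne_zero.1 hn) ⟨K, hK⟩
  refine ⟨k, not_le.1 fun h => hk (hK.trans (hH.mono (by positivity) ?_ ω)), not_le.1 hk, hk'⟩
  gcongr

variable {T : ℕ → Ω → ℝ} {η x : ℝ}

theorem real_gridGapEvent (hH : IsIntervalCount H) (P : Measure Ω) [IsFiniteMeasure P] (n : ℕ)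
    (hη : 0 ≤ η) (y : ℝ) (K : ℕ) :
    P.real (gridGapEvent H n η y K) = ∑ k ∈ Finset.range K,
      P.real (gapEvent H n (k * η) ((k + 1 : ℕ) * η) ((k + 1 : ℕ) * η + y)) := by
  refine measureReal_biUnion_finset (fun k _ m _ hkm => ?_)
    fun k _ => hH.measurableSet_gapEvent _ _ _ _
  have hdisj : ∀ {k m : ℕ}, k < m →
      Disjoint (gapEvent H n (k * η) ((k + 1 : ℕ) * η) ((k + 1 : ℕ) * η + y))
        (gapEvent H n (m * η) ((m + 1 : ℕ) * η) ((m + 1 : ℕ) * η + y)) := fun {k m} hkm =>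
    hH.disjoint_gapEvent (by positivity) (by gcongr; exact hkm)
  exact hkm.lt_or_gt.elim (fun h => hdisj h) fun h => (hdisj h).symm

theorem measurableSet_gridGapEvent (hH : IsIntervalCount H) (n : ℕ) (η y : ℝ) (K : ℕ) :
    MeasurableSet (gridGapEvent H n η y K) :=
  Finset.measurableSet_biUnion _ fun _ _ => hH.measurableSet_gapEvent _ _ _ _

theorem real_gap_le (hH : IsIntervalCount H) (P : Measure Ω) [IsProbabilityMeasure P] (n : ℕ)
    (hη : 0 ≤ η) (hx : 0 ≤ x) (K : ℕ) :
    P.real {ω | T (n + 1) ω - T n ω ≤ x} ≤ 1 - P.real (gridGapEvent H n η x K) +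
      P.real (gridMismatch T H η x K) +
        ∑ k ∈ Finset.range K, P.real {ω | 2 ≤ H (k * η) ((k + 1 : ℕ) * η) ω} := by
  have hsub : {ω | T (n + 1) ω - T n ω ≤ x} ⊆ (gridGapEvent H n η x K)ᶜ ∪
      gridMismatch T H η x K ∪
        ⋃ k ∈ Finset.range K, {ω | 2 ≤ H (k * η) ((k + 1 : ℕ) * η) ω} := by
    intro ω hω
    by_contra hcon
    simp only [mem_union, not_or, mem_compl_iff, not_not] at hcon
    obtain ⟨⟨hgap, hmatch⟩, hdouble⟩ := hcon
    obtain ⟨k, hk, hgap⟩ := mem_iUnion₂.1 hgap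
    have hle := le_iff_of_notMem_gridMismatch hmatch (Finset.mem_range.1 hk)
    have hlt := hH.lt_sub_of_mem_gapEvent (τ := fun m => T m ω) (by positivity)
      (natCast_mul_le_natCast_succ_mul hη k) (le_add_of_nonneg_right hx) hgap
      (not_le.1 fun h => hdouble (mem_biUnion hk h)) (hle n).1 (hle (n + 1)).2
    rw [add_sub_cancel_left] at hlt
    exact hlt.not_ge hω
  rw [← probReal_compl_eq_one_sub (hH.measurableSet_gridGapEvent n η x K)]
  exact (measureReal_mono hsub).trans ((measureReal_union_le _ _).trans
    (add_le_add (measureReal_union_le _ _) (measureReal_biUnion_finset_le _ _)))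

theorem one_sub_le_real_gap (hH : IsIntervalCount H) (P : Measure Ω) [IsProbabilityMeasure P]
    (hn : 1 ≤ n) (hη : 0 ≤ η) (hx : η ≤ x) (K : ℕ) :
    1 - P.real (gridGapEvent H n η (x - η) K) - P.real (gridMismatch T H η (x - η) K) -
      P.real {ω | H 0 (K * η) ω < n} ≤ P.real {ω | T (n + 1) ω - T n ω ≤ x} := by
  have hsub : univ ⊆ {ω | T (n + 1) ω - T n ω ≤ x} ∪ gridGapEvent H n η (x - η) K ∪
      gridMismatch T H η (x - η) K ∪ {ω | H 0 (K * η) ω < n} := by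
    intro ω _
    by_contra hcon
    simp only [mem_union, not_or] at hcon
    obtain ⟨⟨⟨hlong, hgap⟩, hmatch⟩, hfew⟩ := hcon
    obtain ⟨k, hkK, hlt, hle⟩ := hH.exists_cell hη hn (not_lt.1 hfew)
    have hne : H ((k + 1 : ℕ) * η) ((k + 1 : ℕ) * η + (x - η)) ω ≠ 0 := fun h =>
      hgap (mem_biUnion (Finset.mem_coe.2 (Finset.mem_range.2 hkK)) ⟨hlt, hle, h⟩)
    have hshort := hH.sub_lt_of_ne_zero (τ := fun m => T m ω) (by positivity)
      (le_add_of_nonneg_right (sub_nonneg.2 hx)) hlt hle hne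
      (le_iff_of_notMem_gridMismatch hmatch hkK.le n).1
      (le_iff_of_notMem_gridMismatch hmatch hkK (n + 1)).2
    refine hlong (hshort.le.trans (le_of_eq ?_))
    push_cast
    ring
  have hunion := measureReal_mono (μ := P) hsub
  rw [probReal_univ] at hunion
  linarith [measureReal_union_le (μ := P) ({ω | T (n + 1) ω - T n ω ≤ x} ∪
      gridGapEvent H n η (x - η) K ∪ gridMismatch T H η (x - η) K) {ω | H 0 (K * η) ω < n},
    measureReal_union_le (μ := P) ({ω | T (n + 1) ω - T n ω ≤ x} ∪
      gridGapEvent H n η (x - η) K) (gridMismatch T H η (x - η) K),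
    measureReal_union_le (μ := P) {ω | T (n + 1) ω - T n ω ≤ x} (gridGapEvent H n η (x - η) K)]

end IsIntervalCount

/-- Along `l`, the arrival times `T d 1 ≤ T d 2 ≤ …` are asymptotically those of the point process
counted by `H d`, and this point process behaves like a Poisson process of rate one: the points up
to a time are asymptotically independent of there being no point in a later interval, the void
probabilities are asymptotically exponential, and multiple points in short intervals are rare. -/
structure IsAsymptoticallyPoisson {Ω ι : Type*} [MeasurableSpace Ω] (P : Measure Ω) (l : Filter ι)
    (T : ι → ℕ → Ω → ℝ) (H : ι → ℝ → ℝ → Ω → ℕ∞) : Prop where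
  isIntervalCount : ∀ᶠ d in l, IsIntervalCount (H d)
  monotone : ∀ᶠ d in l, ∀ᵐ ω ∂P, Monotone fun n => T d n ω
  timeMismatch : ∀ t ≥ 0, Tendsto (fun d => P.real (timeMismatch (T d) (H d) t)) l (𝓝 0)
  void : ∀ (n : ℕ) (s t u : ℝ), 0 ≤ s → s ≤ t → t ≤ u →
    Tendsto (fun d => P.real {ω | H d 0 s ω < n ∧ H d t u ω = 0} -
      Real.exp (-(u - t)) * P.real {ω | H d 0 s ω < n}) l (𝓝 0)
  two_le : ∃ D : ℝ, ∀ᶠ d in l, ∀ s t, 0 ≤ s → s ≤ t →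
    P.real {ω | 2 ≤ H d s t ω} ≤ D * (t - s) ^ 2

namespace IsAsymptoticallyPoisson

variable {Ω ι : Type*} [MeasurableSpace Ω] {P : Measure Ω} {l : Filter ι}
  {T : ι → ℕ → Ω → ℝ} {H : ι → ℝ → ℝ → Ω → ℕ∞} {n : ℕ} {η x y : ℝ}

theorem tendsto_real_gridMismatch (h : IsAsymptoticallyPoisson P l T H) (hη : 0 ≤ η)
    (hy : 0 ≤ y) (K : ℕ) :
    Tendsto (fun d => P.real (gridMismatch (T d) (H d) η y K)) l (𝓝 0) := by
  refine squeeze_zero (fun _ => measureReal_nonneg) (fun d => real_gridMismatch_le _ _ _ _ _ _) ?_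
  rw [← Finset.sum_const_zero (s := Finset.range (K + 1))]
  refine tendsto_finsetSum _ fun k _ => ?_
  rw [← add_zero (0 : ℝ)]
  exact (h.timeMismatch _ (by positivity)).add (h.timeMismatch _ (by positivity))

variable [IsProbabilityMeasure P]

theorem tendsto_real_eq_zero (h : IsAsymptoticallyPoisson P l T H) {t u : ℝ} (ht : 0 ≤ t)
    (htu : t ≤ u) :
    Tendsto (fun d => P.real {ω | H d t u ω = 0}) l (𝓝 (Real.exp (-(u - t)))) := by
  have hvoid := (h.void 1 0 t u le_rfl ht htu).add_const (Real.exp (-(u - t)))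
  rw [zero_add] at hvoid
  refine hvoid.congr' ?_
  filter_upwards [h.isIntervalCount] with d hH
  simp [hH.self]

theorem eventually_real_lt_le (h : IsAsymptoticallyPoisson P l T H) (hn : 1 ≤ n) {t : ℝ}
    (ht : 0 ≤ t) {ε : ℝ} (hε : 0 < ε) :
    ∀ᶠ d in l, P.real {ω | H d 0 t ω < n} ≤ n * Real.exp (-(t / n)) + ε := by
  have hτ : 0 ≤ t / n := by positivity
  have hlim : Tendsto (fun d => ∑ k ∈ Finset.range n,
      P.real {ω | H d (k * (t / n)) ((k + 1 : ℕ) * (t / n)) ω = 0}) l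
      (𝓝 (n * Real.exp (-(t / n)))) := by
    have hsum := tendsto_finsetSum (Finset.range n) fun k _ =>
      h.tendsto_real_eq_zero (t := k * (t / n)) (by positivity)
        (natCast_mul_le_natCast_succ_mul hτ k)
    have hlength : ∀ k : ℕ, (k + 1 : ℕ) * (t / n) - k * (t / n) = t / n := fun k => by
      push_cast
      ring
    simpa only [hlength, Finset.sum_const, Finset.card_range, nsmul_eq_mul] using hsum
  filter_upwards [h.isIntervalCount, hlim.eventually_lt_const (lt_add_of_pos_right _ hε)]
    with d hH hd
  have hsub : {ω | H d 0 t ω < n} ⊆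
      ⋃ k ∈ Finset.range n, {ω | H d (k * (t / n)) ((k + 1 : ℕ) * (t / n)) ω = 0} := by
    intro ω hω
    by_contra hcon
    have hle := hH.natCast_le_of_forall_ne_zero hτ n fun k hk hzero =>
      hcon (mem_biUnion (Finset.mem_coe.2 (Finset.mem_range.2 hk)) hzero)
    rw [mul_div_cancel₀ t (show (n : ℝ) ≠ 0 by positivity)] at hle
    exact hle.not_gt hω
  exact ((measureReal_mono hsub (measure_ne_top _ _)).trans
    (measureReal_biUnion_finset_le _ _)).trans hd.le

theorem tendsto_real_gapEvent (h : IsAsymptoticallyPoisson P l T H) (n : ℕ) {s t u : ℝ}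
    (hs : 0 ≤ s) (hst : s ≤ t) (htu : t ≤ u) :
    Tendsto (fun d => P.real (gapEvent (H d) n s t u) - Real.exp (-(u - t)) *
      (P.real {ω | H d 0 s ω < n} - P.real {ω | H d 0 t ω < n})) l (𝓝 0) := by
  have hlim := (h.void n s t u hs hst htu).sub (h.void n t t u (hs.trans hst) le_rfl htu)
  rw [sub_zero] at hlim
  refine hlim.congr' ?_
  filter_upwards [h.isIntervalCount] with d hH
  rw [hH.real_gapEvent P n hs hst u]
  ring

theorem tendsto_real_gridGapEvent (h : IsAsymptoticallyPoisson P l T H) (hn : 1 ≤ n)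
    (hη : 0 ≤ η) (hy : 0 ≤ y) (K : ℕ) :
    Tendsto (fun d => P.real (gridGapEvent (H d) n η y K) -
      Real.exp (-y) * (1 - P.real {ω | H d 0 (K * η) ω < n})) l (𝓝 0) := by
  have hsum := tendsto_finsetSum (Finset.range K) fun k _ => h.tendsto_real_gapEvent n
    (s := k * η) (u := (k + 1 : ℕ) * η + y) (by positivity)
    (natCast_mul_le_natCast_succ_mul hη k) (le_add_of_nonneg_right hy)
  rw [Finset.sum_const_zero] at hsum
  refine hsum.congr' ?_
  filter_upwards [h.isIntervalCount] with d hH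
  have hzero : P.real {ω | H d 0 ((0 : ℕ) * η) ω < n} = 1 := by
    simp [hH.self, Nat.pos_iff_ne_zero.1 hn, pos_iff_ne_zero]
  simp only [add_sub_cancel_left]
  rw [hH.real_gridGapEvent P n hη, Finset.sum_sub_distrib, ← Finset.mul_sum,
    Finset.sum_range_sub' (fun k : ℕ => P.real {ω | H d 0 (k * η) ω < n}), hzero]

theorem eventually_real_gap_le (h : IsAsymptoticallyPoisson P l T H) (hn : 1 ≤ n) {D : ℝ}
    (hD : ∀ᶠ d in l, ∀ s t, 0 ≤ s → s ≤ t → P.real {ω | 2 ≤ H d s t ω} ≤ D * (t - s) ^ 2)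
    (hη : 0 ≤ η) (hx : 0 ≤ x) (K : ℕ) {ε : ℝ} (hε : 0 < ε) :
    ∀ᶠ d in l, P.real {ω | T d (n + 1) ω - T d n ω ≤ x} ≤
      1 - Real.exp (-x) + n * Real.exp (-(K * η / n)) + K * (D * η ^ 2) + ε := by
  have hε3 : 0 < ε / 3 := by positivity
  filter_upwards [h.isIntervalCount, hD,
    h.eventually_real_lt_le hn (t := K * η) (by positivity) hε3,
    (h.tendsto_real_gridGapEvent hn hη hx K).eventually_const_lt (neg_neg_of_pos hε3),
    (h.tendsto_real_gridMismatch hη hx K).eventually_lt_const hε3] with d hH hD hfew hgap hmatch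
  have hdouble : ∑ k ∈ Finset.range K, P.real {ω | 2 ≤ H d (k * η) ((k + 1 : ℕ) * η) ω} ≤
      K * (D * η ^ 2) := by
    rw [← nsmul_eq_mul, ← Finset.card_range K, ← Finset.sum_const, Finset.card_range]
    refine Finset.sum_le_sum fun k _ => (hD _ _ (by positivity)
      (natCast_mul_le_natCast_succ_mul hη k)).trans (le_of_eq ?_)
    push_cast
    ring
  have hexp : Real.exp (-x) * P.real {ω | H d 0 (K * η) ω < n} ≤
      P.real {ω | H d 0 (K * η) ω < n} :=
    mul_le_of_le_one_left measureReal_nonneg (Real.exp_le_one_iff.2 (neg_nonpos.2 hx))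
  linarith [hH.real_gap_le (T := T d) P n hη hx K]

theorem eventually_le_real_gap (h : IsAsymptoticallyPoisson P l T H) (hn : 1 ≤ n)
    (hη : 0 ≤ η) (hx : η ≤ x) (K : ℕ) {ε : ℝ} (hε : 0 < ε) :
    ∀ᶠ d in l, 1 - Real.exp (-(x - η)) - n * Real.exp (-(K * η / n)) - ε ≤
      P.real {ω | T d (n + 1) ω - T d n ω ≤ x} := by
  have hε3 : 0 < ε / 3 := by positivity
  filter_upwards [h.isIntervalCount, h.eventually_real_lt_le hn (t := K * η) (by positivity) hε3,
    (h.tendsto_real_gridGapEvent hn hη (sub_nonneg.2 hx) K).eventually_lt_const hε3,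
    (h.tendsto_real_gridMismatch hη (sub_nonneg.2 hx) K).eventually_lt_const hε3]
    with d hH hfew hgap hmatch
  have hexp : 0 ≤ Real.exp (-(x - η)) * P.real {ω | H d 0 (K * η) ω < n} := by positivity
  linarith [hH.one_sub_le_real_gap (T := T d) P hn hη hx K]

theorem tendsto_real_gap_le_of_neg (h : IsAsymptoticallyPoisson P l T H) (n : ℕ) (hx : x < 0) :
    Tendsto (fun d => P.real {ω | T d (n + 1) ω - T d n ω ≤ x}) l (𝓝 0) := by
  refine tendsto_const_nhds.congr' ?_
  filter_upwards [h.monotone] with d hmono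
  symm
  rw [measureReal_eq_zero_iff, measure_eq_zero_iff_ae_notMem]
  filter_upwards [hmono] with ω hω hgap
  exact (hgap.trans_lt hx).not_ge (sub_nonneg.2 (hω n.le_succ))

/-- With `K = m ^ 3` cells of mesh `η = 1 / m ^ 2`, the grid covers the times up to `m`, but the
expected number of cells with two points is still of order `1 / m`. -/
theorem tendsto_real_gap_le_of_nonneg (h : IsAsymptoticallyPoisson P l T H) (hn : 1 ≤ n)
    (hx : 0 ≤ x) :
    Tendsto (fun d => P.real {ω | T d (n + 1) ω - T d n ω ≤ x}) l (𝓝 (1 - Real.exp (-x))) := by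
  obtain ⟨D, hD⟩ := h.two_le
  have hinv : Tendsto (fun m : ℕ => (m : ℝ)⁻¹) atTop (𝓝 0) := tendsto_inv_atTop_nhds_zero_nat
  have hmesh : Tendsto (fun m : ℕ => (m : ℝ)⁻¹ ^ 2) atTop (𝓝 0) := by simpa using hinv.pow 2
  have htail : Tendsto (fun m : ℕ => n * Real.exp (-((m : ℝ) / n))) atTop (𝓝 0) := by
    simpa using (Real.tendsto_exp_neg_atTop_nhds_zero.comp
      (tendsto_natCast_atTop_atTop.atTop_div_const (show (0 : ℝ) < n by positivity))).const_mul
        (n : ℝ)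
  have hcover : ∀ m : ℕ, 0 < m → ((m ^ 3 : ℕ) : ℝ) * (m : ℝ)⁻¹ ^ 2 = m := fun m hm => by
    push_cast
    field_simp
  refine tendsto_order.2 ⟨fun c hc => ?_, fun c hc => ?_⟩
  · rcases hx.eq_or_lt with rfl | hx
    · rw [neg_zero, Real.exp_zero, sub_self] at hc
      exact Eventually.of_forall fun _ => hc.trans_le measureReal_nonneg
    have hlower : Tendsto (fun m : ℕ => 1 - Real.exp (-(x - (m : ℝ)⁻¹ ^ 2)) -
        n * Real.exp (-((m : ℝ) / n)) - (m : ℝ)⁻¹) atTop (𝓝 (1 - Real.exp (-x))) := by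
      simpa using ((((Real.continuous_exp.tendsto _).comp
        (hmesh.const_sub x).neg).const_sub 1).sub htail).sub hinv
    obtain ⟨m, hcm, hmx, hm⟩ := ((hlower.eventually_const_lt hc).and
      ((hmesh.eventually_le_const hx).and (eventually_gt_atTop 0))).exists
    have hm' : 0 < (m : ℝ)⁻¹ := by positivity
    filter_upwards [h.eventually_le_real_gap hn (by positivity) hmx (m ^ 3) hm'] with d hd
    rw [hcover m hm] at hd
    exact hcm.trans_le hd
  · have hupper : Tendsto (fun m : ℕ => 1 - Real.exp (-x) + n * Real.exp (-((m : ℝ) / n)) +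
        D * (m : ℝ)⁻¹ + (m : ℝ)⁻¹) atTop (𝓝 (1 - Real.exp (-x))) := by
      simpa using ((htail.const_add (1 - Real.exp (-x))).add (hinv.const_mul D)).add hinv
    obtain ⟨m, hcm, hm⟩ := ((hupper.eventually_lt_const hc).and (eventually_gt_atTop 0)).exists
    have hm' : 0 < (m : ℝ)⁻¹ := by positivity
    filter_upwards [h.eventually_real_gap_le hn hD (sq_nonneg _) hx (m ^ 3) hm'] with d hd
    have hdouble : ((m ^ 3 : ℕ) : ℝ) * (D * ((m : ℝ)⁻¹ ^ 2) ^ 2) = D * (m : ℝ)⁻¹ := by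
      push_cast
      field_simp
    rw [hcover m hm, hdouble] at hd
    exact hd.trans_lt hcm

theorem tendsto_real_gap_le (h : IsAsymptoticallyPoisson P l T H) (hn : 1 ≤ n) (x : ℝ) :
    Tendsto (fun d => P.real {ω | T d (n + 1) ω - T d n ω ≤ x}) l
      (𝓝 ((expMeasure 1).real (Iic x))) := by
  have := isProbabilityMeasure_expMeasure (r := 1) one_pos
  rw [← cdf_eq_real, cdf_expMeasure_eq one_pos, one_mul]
  split_ifs with hx
  · exact h.tendsto_real_gap_le_of_nonneg hn hx
  · exact h.tendsto_real_gap_le_of_neg n (not_le.1 hx)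

end IsAsymptoticallyPoisson

namespace NetworkParams

variable {M : NetworkParams} (hM : M.WeaklyAdmissible)
include hM

theorem tendsto_exp_div : Tendsto (fun δ => Real.exp (δ / M.a)) atTop atTop :=
  Real.tendsto_exp_atTop.comp (tendsto_id.atTop_div_const hM.a_pos)

theorem tendsto_rateRadius : Tendsto M.rateRadius atTop (𝓝[>] 0) := by
  have hβ : 0 < 1 / M.beta := one_div_pos.2 hM.beta_pos
  refine tendsto_nhdsWithin_iff.2
    ⟨?_, (eventually_gt_atTop 0).mono fun δ hδ => rateRadius_pos hM hδ⟩
  have hbase : Tendsto (fun δ => M.p / (M.w * (Real.exp (δ / M.a) - 1))) atTop (𝓝 0) :=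
    tendsto_const_nhds.div_atTop
      ((tendsto_atTop_add_const_right _ (-1) (tendsto_exp_div hM)).const_mul_atTop hM.w_pos)
  rw [← Real.zero_rpow hβ.ne']
  exact hbase.rpow_const (Or.inr hβ.le)

theorem rateRadius_two_mul_div {δ : ℝ} (hδ : 0 < δ) :
    M.rateRadius (2 * δ) / M.rateRadius δ =
      (1 / (Real.exp (δ / M.a) + 1)) ^ (1 / M.beta) := by
  have := hM.p_pos
  have := hM.w_pos
  have := exp_div_sub_one_pos hM hδ
  have hfactor : Real.exp (2 * δ / M.a) - 1 =
      (Real.exp (δ / M.a) - 1) * (Real.exp (δ / M.a) + 1) := by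
    rw [mul_div_assoc, two_mul, Real.exp_add]
    ring
  rw [rateRadius, rateRadius, coverageRadius, coverageRadius, hfactor,
    ← Real.div_rpow (by positivity) (by positivity)]
  congr 1
  field

theorem tendsto_rateRadius_two_mul_div :
    Tendsto (fun δ => M.rateRadius (2 * δ) / M.rateRadius δ) atTop (𝓝 0) := by
  have hβ : 0 < 1 / M.beta := one_div_pos.2 hM.beta_pos
  have hbase : Tendsto (fun δ => 1 / (Real.exp (δ / M.a) + 1)) atTop (𝓝 0) :=
    tendsto_const_nhds.div_atTop (tendsto_atTop_add_const_right _ 1 (tendsto_exp_div hM))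
  rw [← Real.zero_rpow hβ.ne']
  exact (hbase.rpow_const (Or.inr hβ.le)).congr'
    ((eventually_gt_atTop 0).mono fun δ hδ => (rateRadius_two_mul_div hM hδ).symm)

omit hM

/-- The intensity of the nodes that have no user within their radius of coverage. -/
noncomputable def freeIntensity (M : NetworkParams) : ℝ :=
  M.lam * Real.exp (-(M.xi * Real.pi * M.coverageRadius M.gam ^ 2))

/-- The distance travelled until the time at which the time rescaled by
`2 * M.v * M.rateRadius δ * M.freeIntensity` reads `τ`: the tube of radius `M.rateRadius δ` around
this part of the path contains `τ` nodes without users on average. -/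
noncomputable def scaledDist (M : NetworkParams) (δ τ : ℝ) : ℝ :=
  τ / (2 * M.freeIntensity) / M.rateRadius δ

/-- The number of nodes without users in the tube of radius `M.rateRadius δ` around the path of the
mobile user between the rescaled times `s` and `t`. -/
noncomputable def scaledFreeCount (M : NetworkParams) (b : OrthonormalBasis (Fin 2) ℝ Plane)
    (x u : ℕ → Plane) (δ s t : ℝ) : ℕ∞ :=
  freeCount (M.coverageRadius M.gam) x u
    (pathTube b (M.scaledDist δ s) (M.scaledDist δ t) (M.rateRadius δ))

/-- The rescaled time of the `n`-th up-crossing of the level `δ` by the shared rate. -/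
noncomputable def scaledUpCrossing (M : NetworkParams) (x u : ℕ → Plane) (δ : ℝ) (n : ℕ) : ℝ :=
  2 * M.v * M.rateRadius δ * M.freeIntensity * nthUpCrossing (M.lowerSharedRate x u) δ n

theorem freeIntensity_pos (hl : 0 < M.lam) : 0 < M.freeIntensity :=
  mul_pos hl (Real.exp_pos _)

theorem scaledDist_zero (M : NetworkParams) (δ : ℝ) : M.scaledDist δ 0 = 0 := by
  rw [scaledDist, zero_div, zero_div]

variable (hl : 0 < M.lam) {δ : ℝ} (hδ : 0 < δ)
include hM hl hδ

theorem monotone_scaledDist : Monotone (M.scaledDist δ) := fun s t h => by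
  have := freeIntensity_pos hl
  have := rateRadius_pos hM hδ
  unfold scaledDist
  gcongr

theorem scaledDist_sub_mul (s t : ℝ) :
    (M.scaledDist δ t - M.scaledDist δ s) * (2 * M.rateRadius δ) = (t - s) / M.freeIntensity := by
  have := freeIntensity_pos hl
  have := rateRadius_pos hM hδ
  unfold scaledDist
  field

theorem scaledUpCrossing_le_iff {x u : ℕ → Plane} {n : ℕ} {t : ℝ} :
    M.scaledUpCrossing x u δ n ≤ t ↔
      nthUpCrossing (M.lowerSharedRate x u) δ n ≤ M.scaledDist δ t / M.v := by
  have := freeIntensity_pos hl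
  have := rateRadius_pos hM hδ
  have := hM.v_pos
  rw [scaledUpCrossing, scaledDist, div_div, div_div, le_div_iff₀' (by positivity)]
  ring_nf

end NetworkParams

namespace IsPoissonPointProcess

open NetworkParams

variable {Ω : Type*} [MeasurableSpace Ω] {P : Measure Ω} [IsProbabilityMeasure P]
  {X U : ℕ → Ω → Plane} {M : NetworkParams} (hM : M.WeaklyAdmissible)
  (hX : IsPoissonPointProcess P X M.lam) (hU : IsPoissonPointProcess P U M.xi)
  {b : OrthonormalBasis (Fin 2) ℝ Plane} {δ : ℝ}
include hM hX hU

theorem isIntervalCount_scaledFreeCount (b : OrthonormalBasis (Fin 2) ℝ Plane) (hδ : 0 < δ) :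
    IsIntervalCount fun s t ω =>
      M.scaledFreeCount b (fun i => X i ω) (fun j => U j ω) δ s t where
  measurable s t := measurable_freeCount hX.measurable_point hU.measurable_point _
    (measurableSet_pathTube b _ _ _)
  self s ω := by rw [scaledFreeCount, pathTube_self, freeCount_empty]
  add s t u hst htu ω := by
    have hmono := monotone_scaledDist hM hX.intensity_pos hδ
    rw [scaledFreeCount, scaledFreeCount, scaledFreeCount,
      ← freeCount_union _ _ _ (disjoint_pathTube b le_rfl _),
      pathTube_union b (hmono hst) (hmono htu)]

theorem real_timeMismatch_le (hXU : IndepFun (fun ω i => X i ω) (fun ω j => U j ω) P)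
    (hb : b 0 = M.dir) (hδ : 0 < δ) (hδr : M.rateRadius δ ≤ M.coverageRadius M.gam) {τ : ℝ}
    (hτ : 0 ≤ τ) :
    P.real (timeMismatch
        (fun n ω => M.scaledUpCrossing (fun i => X i ω) (fun j => U j ω) δ n)
        (fun s t ω => M.scaledFreeCount b (fun i => X i ω) (fun j => U j ω) δ s t) τ) ≤
      P.real {ω | ¬ IsSparse b (fun i => X i ω) (M.rateRadius δ) (M.rateRadius (2 * δ))
        (M.scaledDist δ τ)} := by
  refine ENNReal.toReal_mono (measure_ne_top _ _) (measure_mono_ae ?_)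
  filter_upwards [hX.ae_finite_closedBall, hU.ae_finite_closedBall,
    ae_upCrossingSet hM hδ hX hU hXU] with ω hx hu ⟨hinf, hfin⟩ hmismatch hsparse
  refine hmismatch fun n => ?_
  beta_reduce
  have hdist : 0 ≤ M.scaledDist δ τ :=
    (M.scaledDist_zero δ).symm.trans_le (monotone_scaledDist hM hX.intensity_pos hδ hτ)
  rw [scaledUpCrossing_le_iff hM hX.intensity_pos hδ,
    nthUpCrossing_le_iff hinf hfin (div_nonneg hdist hM.v_pos.le),
    encard_upCrossingSet_inter_Iic hM hb hx hu hδ hδr hsparse, scaledFreeCount, scaledDist_zero]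

theorem abs_real_scaledFreeCount_lt_inter_sub_le
    (hXU : IndepFun (fun ω i => X i ω) (fun ω j => U j ω) P)
    (b : OrthonormalBasis (Fin 2) ℝ Plane) (hδ : 0 < δ) (n : ℕ) (q : ℝ) {s t u : ℝ}
    (hst : s ≤ t) (htu : t ≤ u) :
    |P.real {ω | M.scaledFreeCount b (fun i => X i ω) (fun j => U j ω) δ q s < n ∧
          M.scaledFreeCount b (fun i => X i ω) (fun j => U j ω) δ t u = 0} -
        Real.exp (-(u - t)) *
          P.real {ω | M.scaledFreeCount b (fun i => X i ω) (fun j => U j ω) δ q s < n}| ≤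
      M.lam * √(8 * M.coverageRadius M.gam * M.rateRadius δ *
        ((u - t) / M.freeIntensity)) := by
  have hl := hX.intensity_pos
  have hmono := monotone_scaledDist hM hl hδ
  have hvol := hU.integral_abs_volume_freeRegion_pathTube_sub_le
    (coverageRadius_pos hM hM.gam_pos).le hl.le b (hmono htu) (rateRadius_pos hM hδ).le
  rw [scaledDist_sub_mul hM hl hδ, ← freeIntensity,
    mul_div_cancel₀ _ (freeIntensity_pos hl).ne'] at hvol
  exact (hX.abs_real_freeCount_lt_inter_sub_le hU.measurable_point hXU _
    (measurableSet_pathTube b _ _ _) (measurableSet_pathTube b _ _ _)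
    (volume_pathTube_ne_top b _ _ _) (disjoint_pathTube b (hmono hst) _) n
    (sub_nonneg.2 htu)).trans hvol

omit hU in
theorem real_two_le_scaledFreeCount_le (U : ℕ → Ω → Plane)
    (b : OrthonormalBasis (Fin 2) ℝ Plane) (hδ : 0 < δ) {s t : ℝ} (hst : s ≤ t) :
    P.real {ω | 2 ≤ M.scaledFreeCount b (fun i => X i ω) (fun j => U j ω) δ s t} ≤
      (M.lam / M.freeIntensity) ^ 2 * (t - s) ^ 2 := by
  have hl := hX.intensity_pos
  calc P.real {ω | 2 ≤ M.scaledFreeCount b (fun i => X i ω) (fun j => U j ω) δ s t}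
    _ ≤ P.real {ω | 2 ≤ pointCount (fun i => X i ω)
          (pathTube b (M.scaledDist δ s) (M.scaledDist δ t) (M.rateRadius δ))} :=
      measureReal_mono (fun ω hω => le_trans hω (freeCount_le_pointCount _ _ _ _))
        (measure_ne_top _ _)
    _ ≤ (M.lam * volume.real
          (pathTube b (M.scaledDist δ s) (M.scaledDist δ t) (M.rateRadius δ))) ^ 2 :=
      hX.real_two_le_count_le (measurableSet_pathTube b _ _ _) (volume_pathTube_ne_top b _ _ _)
    _ = (M.lam / M.freeIntensity) ^ 2 * (t - s) ^ 2 := by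
      rw [volume_real_pathTube b (monotone_scaledDist hM hl hδ hst) (rateRadius_pos hM hδ).le,
        scaledDist_sub_mul hM hl hδ]
      ring

theorem isAsymptoticallyPoisson_scaledUpCrossing
    (hXU : IndepFun (fun ω i => X i ω) (fun ω j => U j ω) P) (hb : b 0 = M.dir) :
    IsAsymptoticallyPoisson P atTop
      (fun δ n ω => M.scaledUpCrossing (fun i => X i ω) (fun j => U j ω) δ n)
      (fun δ s t ω => M.scaledFreeCount b (fun i => X i ω) (fun j => U j ω) δ s t) where
  isIntervalCount := (eventually_gt_atTop 0).mono fun δ hδ =>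
    isIntervalCount_scaledFreeCount hM hX hU b hδ
  monotone := by
    filter_upwards [eventually_gt_atTop 0] with δ hδ
    filter_upwards [ae_upCrossingSet hM hδ hX hU hXU] with ω ⟨hinf, hfin⟩
    have := hM.v_pos
    have := rateRadius_pos hM hδ
    have := freeIntensity_pos hX.intensity_pos
    exact (monotone_nthUpCrossing hinf hfin).const_mul (by positivity)
  timeMismatch τ hτ := by
    have hA : 0 ≤ τ / (2 * M.freeIntensity) :=
      div_nonneg hτ (mul_pos two_pos (freeIntensity_pos hX.intensity_pos)).le
    refine squeeze_zero' (Eventually.of_forall fun _ => measureReal_nonneg) ?_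
      (hX.tendsto_real_not_isSparse b hA (tendsto_rateRadius hM)
        ((eventually_gt_atTop 0).mono fun δ hδ => (rateRadius_pos hM (mul_pos two_pos hδ)).le)
        (tendsto_rateRadius_two_mul_div hM))
    filter_upwards [eventually_gt_atTop 0, (tendsto_nhdsWithin_iff.1
      (tendsto_rateRadius hM)).1.eventually_le_const (coverageRadius_pos hM hM.gam_pos)]
      with δ hδ hδr using real_timeMismatch_le hM hX hU hXU hb hδ hδr hτ
  void n s t u _ hst htu := by
    have herror : Continuous fun ρ : ℝ => M.lam * √(8 * M.coverageRadius M.gam * ρ *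
        ((u - t) / M.freeIntensity)) := by fun_prop
    have hlim := (herror.tendsto' 0 0 (by simp)).comp
      ((tendsto_rateRadius hM).mono_right nhdsWithin_le_nhds)
    refine squeeze_zero_norm' ?_ hlim
    filter_upwards [eventually_gt_atTop 0] with δ hδ
    exact abs_real_scaledFreeCount_lt_inter_sub_le hM hX hU hXU b hδ n 0 hst htu
  two_le := ⟨_, (eventually_gt_atTop 0).mono fun δ hδ _ _ _ hst =>
    real_two_le_scaledFreeCount_le hM hX U b hδ hst⟩

end IsPoissonPointProcess

theorem mainTheorem10_general {Ω : Type*} [MeasurableSpace Ω] (P : Measure Ω)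
    [IsProbabilityMeasure P] (M : NetworkParams) (hM : M.WeaklyAdmissible)
    (X U : ℕ → Ω → Plane)
    (hX : IsPoissonPointProcess P X M.lam)
    (hU : IsPoissonPointProcess P U M.xi)
    (hXU : IndepFun (fun ω i => X i ω) (fun ω j => U j ω) P)
    (S : Ω → ℝ → ℝ)
    (hS : ∀ ω t, S ω t = M.lowerSharedRate (fun i => X i ω) (fun j => U j ω) t) :
    (∀ δ > 0, ∀ᵐ ω ∂P, (upCrossingSet (S ω) δ).Infinite ∧
      ∀ t : ℝ, (upCrossingSet (S ω) δ ∩ Iic t).Finite) ∧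
    ∀ n : ℕ, 1 ≤ n → ∀ x : ℝ,
      Tendsto
        (fun δ : ℝ => P.real {ω |
          2 * M.lam * M.v * M.rateRadius δ *
              Real.exp (-(M.xi * Real.pi * M.coverageRadius M.gam ^ 2)) *
            (nthUpCrossing (S ω) δ (n + 1) - nthUpCrossing (S ω) δ n) ≤ x})
        atTop (𝓝 ((expMeasure 1).real (Iic x))) := by
  obtain rfl : S = fun ω => M.lowerSharedRate (fun i => X i ω) (fun j => U j ω) :=
    funext fun ω => funext (hS ω)
  refine ⟨fun δ hδ => IsPoissonPointProcess.ae_upCrossingSet hM hδ hX hU hXU, fun n hn x => ?_⟩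
  obtain ⟨b, hb⟩ := exists_orthonormalBasis_zero_eq hM.norm_dir
  have hgap := (IsPoissonPointProcess.isAsymptoticallyPoisson_scaledUpCrossing hM hX hU hXU
    hb).tendsto_real_gap_le hn x
  have hrate (δ : ℝ) : 2 * M.lam * M.v * M.rateRadius δ *
      Real.exp (-(M.xi * Real.pi * M.coverageRadius M.gam ^ 2)) =
        2 * M.v * M.rateRadius δ * M.freeIntensity := by
    rw [NetworkParams.freeIntensity]
    ring
  simpa only [hrate, mul_sub, NetworkParams.scaledUpCrossing] using hgap

theorem mainTheorem10 {Ω : Type*} [MeasurableSpace Ω] (P : Measure Ω) [IsProbabilityMeasure P]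
    (M : NetworkParams) (hM : M.Admissible)
    (X U : ℕ → Ω → Plane)
    (hX : IsPoissonPointProcess P X M.lam)
    (hU : IsPoissonPointProcess P U M.xi)
    (hXU : IndepFun (fun ω i => X i ω) (fun ω j => U j ω) P)
    (S : Ω → ℝ → ℝ)
    (hS : ∀ ω t, S ω t = M.lowerSharedRate (fun i => X i ω) (fun j => U j ω) t) :
    (∀ δ > 0, ∀ᵐ ω ∂P, (upCrossingSet (S ω) δ).Infinite ∧
      ∀ t : ℝ, (upCrossingSet (S ω) δ ∩ Iic t).Finite) ∧
    ∀ n : ℕ, 1 ≤ n → ∀ x : ℝ,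
      Tendsto
        (fun δ : ℝ => P.real {ω |
          2 * M.lam * M.v * M.rateRadius δ *
              Real.exp (-(M.xi * Real.pi * M.coverageRadius M.gam ^ 2)) *
            (nthUpCrossing (S ω) δ (n + 1) - nthUpCrossing (S ω) δ n) ≤ x})
        atTop (𝓝 ((expMeasure 1).real (Iic x))) :=
  mainTheorem10_general P M hM.weaklyAdmissible X U hX hU hXU S hS
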